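/- Let $(V,\eta)$ be $\mathbb R^3$ with the Lorentzian inner product given in a null basis by $\eta_{02}=\eta_{20}=-1$, $\eta_{11}=\tfrac12$, all other $\eta_{ab}=0$; let $O(\eta)$ be its full automorphism group, acting on $\mathcal R^p=\otimes^4V^*\oplus\cdots\oplus\otimes^{4+p}V^*$. Let $(M,g)$ be a smooth 3-dimensional Lorentzian manifold. A moving frame is a triple of smooth vector fields $(e_0,e_1,e_2)$ on an open set $U\subset M$ with $g(e_a,e_b)=\eta_{ab}$; relative to it, $R^{(p)}=(R_{abcd},R_{abcd;e_1},\dots,R_{abcd;e_1\cdots e_p}):U\to\mathcal R^p$ denotes the components of the Riemann tensor and of its first $p$ covariant derivatives. A submanifold $S\subset\mathcal R^p$ is a *$p$th order normalizing cross-section* for $(M,g)$ if there is a subgroup $G_p\subset O(\eta)$ that fixes $S$ pointwise and contains every $X\in O(\eta)$ with $X(S)\cap S\ne\emptyset$, and if $M$ is covered by the domains of moving frames that are normalized by $S$, i.e. whose $R^{(p)}$ takes values in $S$. The components of $R^{(p)}$ in such a frame are the $p$th order Cartan invariants, and $t_p$ is the maximal rank of $R^{(p)}$ in such frames. $(M,g)$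 is *curvature regular* if a normalizing cross-section exists for every $p\ge 0$. It is $\mathrm{CH}_k$ if it is curvature regular and $t_k=0$, and *properly* $\mathrm{CH}_k$ if moreover $t_{k+1}>0$ (relative to some normalizing cross-sections of orders $k$ and $k+1$). Let $S_{ab}$ be the trace-free Ricci tensor and $\Psi_0=S_{00}$, $\Psi_1=S_{01}$, $\Psi_2=S_{02}=S_{11}$, $\Psi_3=S_{12}$, $\Psi_4=S_{22}$. $(M,g)$ is of *type DZ* if at every point, in a null frame with $\Psi_4\neq0$, the quartic $\Psi_0+4\Psi_1z+6\Psi_2z^2+4\Psi_3z^3+\Psi_4z^4$ has a pair of complex conjugate, non-real double roots (equivalently, a frame can be chosen there with $\Psi_1=\Psi_3=0$, $\Psi_0=\Psi_4=3\Psi_2\ne0$). **Proposition.** A 3-dimensional Lorentzian manifold of type DZ is never properly $\mathrm{CH}_1$. In fact, if $(M,g)$ is of type DZ and $\mathrm{CH}_1$, then all its 2nd order Cartan invariants are constant: for every 2nd order normalizing cross-section $S$ and every connected subset $C\subset M$ there is $c\in\mathcal R^2$ such that $R^{(2)}(x)=c$ for every moving frame normalized by $S$ and every $x\in C$ in its domain.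 -/

import Mathlib

open scoped Manifold ContDiff Matrix

namespace LorentzThree

noncomputable section

/-- The inner product `η` on `V = ℝ³` in a null basis `(ℓ, m, n)`: `η(ℓ, n) = -1`,
`η(m, m) = 1/2`, all other products zero. -/
def eta : Matrix (Fin 3) (Fin 3) ℝ := !![0, 0, -1; 0, 1 / 2, 0; -1, 0, 0]

/-- The matrix `η^{ab}`, inverse to `η_{ab}`. -/
def etaInv : Matrix (Fin 3) (Fin 3) ℝ := !![0, 0, -1; 0, 2, 0; -1, 0, 0]

/-- The full Lorentz group `O(η)` of automorphisms of `(V, η)`. -/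
def lorentzGroup : Subgroup (GL (Fin 3) ℝ) where
  carrier := {X | X.valᵀ * eta * X.val = eta}
  one_mem' := by simp
  mul_mem' := by
    intro X Y (hX : X.valᵀ * eta * X.val = eta) (hY : Y.valᵀ * eta * Y.val = eta)
    change (X * Y).valᵀ * eta * (X * Y).val = eta
    rw [Units.val_mul, Matrix.transpose_mul,
      show Y.valᵀ * X.valᵀ * eta * (X.val * Y.val) = Y.valᵀ * (X.valᵀ * eta * X.val) * Y.val by
        simp only [Matrix.mul_assoc], hX, hY]
  inv_mem' := by
    intro X (hX : X.valᵀ * eta * X.val = eta)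
    change X⁻¹.valᵀ * eta * X⁻¹.val = eta
    have h : X.val * X⁻¹.val = 1 := X.mul_inv
    have ht : X⁻¹.valᵀ * X.valᵀ = 1 := by
      rw [← Matrix.transpose_mul, h, Matrix.transpose_one]
    calc X⁻¹.valᵀ * eta * X⁻¹.val
        = X⁻¹.valᵀ * (X.valᵀ * eta * X.val) * X⁻¹.val := by rw [hX]
      _ = (X⁻¹.valᵀ * X.valᵀ) * eta * (X.val * X⁻¹.val) := by simp only [Matrix.mul_assoc]
      _ = eta := by rw [ht, h, Matrix.one_mul, Matrix.mul_one]

/-- The component array `T_{a₁ … a_k}` of an element of `⊗ᵏ V*`. -/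
abbrev Tensor (k : ℕ) : Type := (Fin k → Fin 3) → ℝ

/-- The action of `X` on covariant tensors, `(X • T)(v₁, …, v_k) = T(X⁻¹ v₁, …, X⁻¹ v_k)`. -/
def tensorAct (X : GL (Fin 3) ℝ) {k : ℕ} (T : Tensor k) : Tensor k := fun a =>
  ∑ b : Fin k → Fin 3,
    (∏ i, X⁻¹.val (b i) (a i)) * T b

/-- The space `𝓡ᵖ = ⊗⁴ V* ⊕ ⋯ ⊕ ⊗⁴⁺ᵖ V*`. -/
abbrev CurvatureSpace (p : ℕ) : Type := (k : Fin (p + 1)) → Tensor (4 + k)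

/-- The diagonal action on `𝓡ᵖ`. -/
def curvatureAct (X : GL (Fin 3) ℝ) {p : ℕ} (T : CurvatureSpace p) : CurvatureSpace p :=
  fun k => tensorAct X (T k)

/-- Smooth embedded submanifolds of a normed space, described by slice charts: near each of its
points `S` is carried to a piece of a linear subspace by a smooth diffeomorphism of open sets. -/
def IsSubmanifold {E : Type*} [NormedAddCommGroup E] [NormedSpace ℝ E] (S : Set E) : Prop :=
  ∀ s ∈ S, ∃ (W : Submodule ℝ E) (φ : OpenPartialHomeomorph E E), s ∈ φ.source ∧
    ContDiffOn ℝ ∞ φ φ.source ∧ ContDiffOn ℝ ∞ φ.symm φ.target ∧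
    φ '' (S ∩ φ.source) = (W : Set E) ∩ φ.target

/-- A smooth Lorentzian metric, of signature `(-, +, +)`, on a smooth 3-manifold. -/
structure LorentzianMetric (M : Type*) [TopologicalSpace M]
    [ChartedSpace (EuclideanSpace ℝ (Fin 3)) M] [IsManifold (𝓡 3) ∞ M] where
  /-- The scalar product on each tangent space. -/
  inner (x : M) : TangentSpace (𝓡 3) x →L[ℝ] TangentSpace (𝓡 3) x →L[ℝ] ℝ
  symm (x : M) (v w : TangentSpace (𝓡 3) x) : inner x v w = inner x w v
  signature (x : M) : ∃ v : Fin 3 → TangentSpace (𝓡 3) x,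
    ∀ i j, inner x (v i) (v j) = Matrix.diagonal ![-1, 1, 1] i j
  contMDiff : ContMDiff (𝓡 3)
    ((𝓡 3).prod 𝓘(ℝ, EuclideanSpace ℝ (Fin 3) →L[ℝ] EuclideanSpace ℝ (Fin 3) →L[ℝ] ℝ)) ∞
    (fun x => Bundle.TotalSpace.mk'
      (EuclideanSpace ℝ (Fin 3) →L[ℝ] EuclideanSpace ℝ (Fin 3) →L[ℝ] ℝ) x (inner x))

/-- A moving `η`-frame: smooth vector fields `e₀ = ℓ`, `e₁ = m`, `e₂ = n` on an open set with
`g(e_a, e_b) = η_{ab}` there. Values off the domain are irrelevant. -/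
structure MovingFrame {M : Type*} [TopologicalSpace M]
    [ChartedSpace (EuclideanSpace ℝ (Fin 3)) M] [IsManifold (𝓡 3) ∞ M]
    (g : LorentzianMetric M) where
  domain : Set M
  isOpen_domain : IsOpen domain
  /-- The vector fields of the frame. -/
  vec : Fin 3 → (x : M) → TangentSpace (𝓡 3) x
  smooth : ∀ a, ContMDiffOn (𝓡 3) (𝓡 3).tangent ∞
    (fun x => (⟨x, vec a x⟩ : TangentBundle (𝓡 3) M)) domain
  inner_eq : ∀ x ∈ domain, ∀ a b, g.inner x (vec a x) (vec b x) = eta a b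

namespace MovingFrame

variable {M : Type*} [TopologicalSpace M] [ChartedSpace (EuclideanSpace ℝ (Fin 3)) M]
  [IsManifold (𝓡 3) ∞ M] {g : LorentzianMetric M}

/-- The frame derivative `e_a(f)`. -/
def frameDeriv (e : MovingFrame g) (a : Fin 3) (f : M → ℝ) (x : M) : ℝ :=
  (mfderiv (𝓡 3) 𝓘(ℝ, ℝ) f x (e.vec a x) : ℝ)

/-- `g([e_a, e_b], e_c)`. -/
def bracketLow (e : MovingFrame g) (a b c : Fin 3) (x : M) : ℝ :=
  g.inner x (VectorField.mlieBracket (𝓡 3) (e.vec a) (e.vec b) x) (e.vec c x)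

/-- The commutator coefficients `c^f_{ab}`, where `[e_a, e_b] = c^f_{ab} e_f`. -/
def bracketCoeff (e : MovingFrame g) (f a b : Fin 3) (x : M) : ℝ :=
  ∑ h, etaInv f h * e.bracketLow a b h x

/-- `Γ_{abc} = g(∇_{e_c} e_b, e_a)` for the Levi-Civita connection, by the Koszul formula
(the products `g(e_a, e_b)` are constant). -/
def connLow (e : MovingFrame g) (a b c : Fin 3) (x : M) : ℝ :=
  (e.bracketLow c b a x - e.bracketLow b a c x + e.bracketLow a c b x) / 2

/-- The Levi-Civita connection components: `∇_{e_c} e_b = Γ^a_{bc} e_a`, that is, the connection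
1-forms are `Γ^a_b = Γ^a_{bc} ω^c`. -/
def conn (e : MovingFrame g) (a b c : Fin 3) (x : M) : ℝ :=
  ∑ h, etaInv a h * e.connLow h b c x

/-- `R^a_{bcd}`, the components of `Ω^a_b = dΓ^a_b + Γ^a_f ∧ Γ^f_b = ½ R^a_{bcd} ω^c ∧ ω^d`. -/
def riemannUp (e : MovingFrame g) (a b c d : Fin 3) (x : M) : ℝ :=
  e.frameDeriv c (e.conn a b d) x - e.frameDeriv d (e.conn a b c) x
    + ∑ f, (e.conn a f c x * e.conn f b d x - e.conn a f d x * e.conn f b c x)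
    - ∑ f, e.bracketCoeff f c d x * e.conn a b f x

/-- The curvature components `R_{abcd}`. -/
def riemann (e : MovingFrame g) (a b c d : Fin 3) (x : M) : ℝ :=
  ∑ f, eta a f * e.riemannUp f b c d x

/-- The Ricci components `R_{ab} = R^c_{acb}`. -/
def ricci (e : MovingFrame g) (a b : Fin 3) (x : M) : ℝ := ∑ c, e.riemannUp c a c b x

/-- The scalar curvature `R = R^a_a`. -/
def scalar (e : MovingFrame g) (x : M) : ℝ := ∑ a, ∑ b, etaInv a b * e.ricci a b x

/-- The trace-free Ricci components `S_{ab} = R_{ab} - R g_{ab} / 3`. -/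
def tracefreeRicci (e : MovingFrame g) (a b : Fin 3) (x : M) : ℝ :=
  e.ricci a b x - e.scalar x / 3 * eta a b

/-- The curvature scalars `Ψ₀, …, Ψ₄`: `S₀₀ = Ψ₀`, `S₀₁ = Ψ₁`, `S₀₂ = S₁₁ = Ψ₂`, `S₁₂ = Ψ₃`,
`S₂₂ = Ψ₄`. -/
def psi (e : MovingFrame g) (i : Fin 5) (x : M) : ℝ :=
  ![e.tracefreeRicci 0 0 x, e.tracefreeRicci 0 1 x, e.tracefreeRicci 0 2 x,
    e.tracefreeRicci 1 2 x, e.tracefreeRicci 2 2 x] i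

/-- The covariant derivative of a tensor field given by its frame components,
`T_{a₁…a_k;c} = e_c(T_{a₁…a_k}) - ∑ᵢ Γ^b_{aᵢ c} T_{a₁…b…a_k}`; the new index is the last one. -/
def covDeriv (e : MovingFrame g) {k : ℕ} (T : M → Tensor k) : M → Tensor (k + 1) := fun x a =>
  e.frameDeriv (a (Fin.last k)) (fun y => T y (Fin.init a)) x
    - ∑ i : Fin k, ∑ b : Fin 3,
        e.conn b (Fin.init a i) (a (Fin.last k)) x * T x (Function.update (Fin.init a) i b)

/-- The components `R_{abcd;e₁…e_k}` of the `k`th covariant derivative of the curvature. -/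
def curvatureDeriv (e : MovingFrame g) : (k : ℕ) → M → Tensor (4 + k)
  | 0 => fun x a => e.riemann (a 0) (a 1) (a 2) (a 3) x
  | k + 1 => e.covDeriv (e.curvatureDeriv k)

/-- `R^{(p)} = (R_{abcd}, R_{abcd;e}, …, R_{abcd;e₁…e_p})` relative to the moving frame. -/
def curvatureJet (e : MovingFrame g) (p : ℕ) (x : M) : CurvatureSpace p :=
  fun k => e.curvatureDeriv k x

/-- The rank at `x` of the map `R^{(p)}`. -/
def jetRank (e : MovingFrame g) (p : ℕ) (x : M) : ℕ :=
  Module.finrank ℝ (LinearMap.range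
    (mfderiv (𝓡 3) 𝓘(ℝ, CurvatureSpace p) (e.curvatureJet p) x).toLinearMap)

theorem jetRank_le (e : MovingFrame g) (p : ℕ) (x : M) : e.jetRank p x ≤ 3 := by
  have : FiniteDimensional ℝ (TangentSpace (𝓡 3) x) :=
    inferInstanceAs (FiniteDimensional ℝ (EuclideanSpace ℝ (Fin 3)))
  have h : Module.finrank ℝ (TangentSpace (𝓡 3) x) = 3 :=
    (finrank_euclideanSpace_fin : Module.finrank ℝ (EuclideanSpace ℝ (Fin 3)) = 3)
  exact (LinearMap.finrank_range_le _).trans h.le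

/-- The frame is normalized by `S`: the image of `R^{(p)}` lies in `S`. The components of
`R^{(p)}` are then the `p`th order Cartan invariants. -/
def IsNormalized (e : MovingFrame g) {p : ℕ} (S : Set (CurvatureSpace p)) : Prop :=
  ∀ x ∈ e.domain, e.curvatureJet p x ∈ S

end MovingFrame

namespace LorentzianMetric

variable {M : Type*} [TopologicalSpace M] [ChartedSpace (EuclideanSpace ℝ (Fin 3)) M]
  [IsManifold (𝓡 3) ∞ M]

/-- `S ⊆ 𝓡ᵖ` is a `p`th order normalizing cross-section for `(M, g)`. -/
structure IsNormalizingCrossSection (g : LorentzianMetric M) {p : ℕ}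
    (S : Set (CurvatureSpace p)) : Prop where
  submanifold : IsSubmanifold S
  /-- A subgroup `G` of `O(η)` fixes `S` pointwise, and is maximal in the sense that
  `X(S) ∩ S ≠ ∅`, `X ∈ O(η)`, implies `X ∈ G`. -/
  exists_subgroup : ∃ G : Subgroup (GL (Fin 3) ℝ), G ≤ lorentzGroup ∧
    (∀ X ∈ G, ∀ s ∈ S, curvatureAct X s = s) ∧
    ∀ X ∈ lorentzGroup, ((curvatureAct X '' S) ∩ S).Nonempty → X ∈ G
  /-- `M` is covered by moving frames normalized by `S`. -/
  cover : ∀ x : M, ∃ e : MovingFrame g, x ∈ e.domain ∧ e.IsNormalized S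

/-- Curvature regularity: there is a normalizing cross-section of every order. -/
def IsCurvatureRegular (g : LorentzianMetric M) : Prop :=
  ∀ p : ℕ, ∃ S : Set (CurvatureSpace p), g.IsNormalizingCrossSection S

/-- The horizontal rank `t_p` relative to the cross-section `S`: the maximal rank of `R^{(p)}`
computed in moving frames normalized by `S` (a maximum of numbers that are at most 3). -/
def horizontalRank (g : LorentzianMetric M) {p : ℕ} (S : Set (CurvatureSpace p)) : ℕ :=
  sSup {r | ∃ e : MovingFrame g, e.IsNormalized S ∧ ∃ x ∈ e.domain, r = e.jetRank p x}

/-- `CH_k`, curvature homogeneous of order `k`: curvature regular with `t_k = 0`. -/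
def IsCH (g : LorentzianMetric M) (k : ℕ) : Prop :=
  g.IsCurvatureRegular ∧
    ∃ S : Set (CurvatureSpace k), g.IsNormalizingCrossSection S ∧ g.horizontalRank S = 0

/-- Properly `CH_k`: `t_k = 0` and `t_{k+1} > 0`. -/
def IsProperlyCH (g : LorentzianMetric M) (k : ℕ) : Prop :=
  g.IsCH k ∧
    ∃ S : Set (CurvatureSpace (k + 1)), g.IsNormalizingCrossSection S ∧ 0 < g.horizontalRank S

/-- The curvature is of Petrov type DZ at `x`: in a null frame with `Ψ₄ ≠ 0` the quartic
`Ψ₀ + 4 Ψ₁ z + 6 Ψ₂ z² + 4 Ψ₃ z³ + Ψ₄ z⁴` has two complex conjugate, non-real double roots. -/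
def IsTypeDZAt (g : LorentzianMetric M) (x : M) : Prop :=
  ∃ e : MovingFrame g, x ∈ e.domain ∧ e.psi 4 x ≠ 0 ∧ ∃ w : ℂ, w.im ≠ 0 ∧ ∀ z : ℂ,
    (e.psi 0 x : ℂ) + 4 * (e.psi 1 x : ℂ) * z + 6 * (e.psi 2 x : ℂ) * z ^ 2
      + 4 * (e.psi 3 x : ℂ) * z ^ 3 + (e.psi 4 x : ℂ) * z ^ 4
      = (e.psi 4 x : ℂ) * (z - w) ^ 2 * (z - (starRingEnd ℂ) w) ^ 2

/-- The geometry is of type DZ: its curvature is of type DZ at every point. -/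
def IsTypeDZ (g : LorentzianMetric M) : Prop := ∀ x : M, g.IsTypeDZAt x

end LorentzianMetric

end

end LorentzThree

set_option linter.unusedSectionVars false

/-! In dimension three the Ricci tensor determines the Riemann tensor. Type DZ says that, pointwise,
the trace-free Ricci tensor is a nonzero multiple of the trace-free part of `u ⊗ u` for a timelike
covector `u`. In a canonical frame the curvature is therefore an `axialCurvature κ β` with `β ≠ 0`
(`riemann_eq_axialCurvature`), and it is invariant under the rotations about `u`.

Suppose the geometry is `CH₁`. Near a point the 1-jet of the curvature is constant in some frame. A
constant Lorentz matrix makes that frame canonical at the point, hence on a whole neighbourhood.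
There `∇R` is minus the connection matrices acting on a constant tensor, so it sees the connection
only through `∇u`. As `β ≠ 0`, the six components `b c = Γ_{02c}` and `k c = Γ_{12c} - Γ_{01c}` are
constant. The components `spin c` along the rotation remain free, and `∇²R` depends on them only
through the infinitesimal rotation of `∇R`.

Six of the structure equations are algebraic and affine in the spin (`structure_equations`), so
differences of spin values solve a homogeneous linear system. This leaves three cases
(`curvatureDeriv_two_const`). (1) `∇u` is rotation invariant, that is, `u` is geodesic and
shear-free. Then `∇R` is rotation invariant and the spin drops out of `∇²R`. (2) `u` has shear. The
linear system has only the zero solution (`collinear_cross`), so the spin is constant. (3) `u` is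
shear-free and accelerated. Enough spin components are constant to make the remaining structure
equation algebraic as well, and together the equations force `β = 0` (`eq_zero_of_shearfree`), a
contradiction.

So the 2-jet is locally constant in some frame. Covariance of all curvature derivatives under
changes of frame (`curvatureDeriv_transition`) places the values in a normalized frame in a single
`O(η)`-orbit. A normalizing cross-section meets an orbit in at most one point
(`eq_of_curvatureAct`), so the Cartan invariants are locally constant. -/

namespace LorentzThree

open Bundle

noncomputable section

variable {M : Type*} [TopologicalSpace M] [ChartedSpace (EuclideanSpace ℝ (Fin 3)) M]
  [IsManifold (𝓡 3) ∞ M] {g : LorentzianMetric M}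

/-! ### Smooth functions and vector fields -/

/-- Smoothness of a real function on a set. -/
abbrev IsSmoothOn (f : M → ℝ) (U : Set M) : Prop := ContMDiffOn (𝓡 3) 𝓘(ℝ, ℝ) ∞ f U

/-- Smoothness of a vector field on a set. -/
abbrev IsSmoothFieldOn (V : (x : M) → TangentSpace (𝓡 3) x) (U : Set M) : Prop :=
  ContMDiffOn (𝓡 3) (𝓡 3).tangent ∞ (fun x => (⟨x, V x⟩ : TangentBundle (𝓡 3) M)) U

/-- Differentiability of a real function at a point. -/
abbrev IsDiffAt (f : M → ℝ) (x : M) : Prop := MDifferentiableAt (𝓡 3) 𝓘(ℝ, ℝ) f x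

instance : IsManifold (𝓡 3) (∞ + 1) M := by
  have : (∞ + 1 : WithTop ℕ∞) = ∞ := rfl
  rw [this]; infer_instance

instance : IsManifold (𝓡 3) (minSmoothness ℝ 3) M := by
  rw [minSmoothness_of_isRCLikeNormedField]; infer_instance

theorem IsSmoothOn.isDiffAt {f : M → ℝ} {U : Set M} (hf : IsSmoothOn f U) (hU : IsOpen U) {x : M}
    (hx : x ∈ U) : IsDiffAt f x :=
  (hf.contMDiffAt (hU.mem_nhds hx)).mdifferentiableAt (by simp)

theorem IsSmoothFieldOn.mdifferentiableAt {V : (x : M) → TangentSpace (𝓡 3) x} {U : Set M}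
    (hV : IsSmoothFieldOn V U) (hU : IsOpen U) {x : M} (hx : x ∈ U) :
    MDifferentiableAt (𝓡 3) (𝓡 3).tangent (fun x => (⟨x, V x⟩ : TangentBundle (𝓡 3) M)) x :=
  (hV.contMDiffAt (hU.mem_nhds hx)).mdifferentiableAt (by simp)

theorem IsSmoothOn.const (c : ℝ) (U : Set M) : IsSmoothOn (fun _ => c) U := contMDiffOn_const

theorem IsSmoothOn.add {f f' : M → ℝ} {U : Set M} (hf : IsSmoothOn f U) (hf' : IsSmoothOn f' U) :
    IsSmoothOn (fun x => f x + f' x) U := ContMDiffOn.add hf hf'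

theorem IsSmoothOn.mul {f f' : M → ℝ} {U : Set M} (hf : IsSmoothOn f U) (hf' : IsSmoothOn f' U) :
    IsSmoothOn (fun x => f x * f' x) U := ContMDiffOn.mul hf hf'

theorem IsSmoothOn.const_mul {f : M → ℝ} {U : Set M} (c : ℝ) (hf : IsSmoothOn f U) :
    IsSmoothOn (fun x => c * f x) U := (IsSmoothOn.const c U).mul hf

theorem IsSmoothOn.sub {f f' : M → ℝ} {U : Set M} (hf : IsSmoothOn f U) (hf' : IsSmoothOn f' U) :
    IsSmoothOn (fun x => f x - f' x) U := by
  simpa [sub_eq_add_neg] using hf.add (hf'.const_mul (-1))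

theorem IsSmoothOn.sum {ι : Type} (s : Finset ι) {f : ι → M → ℝ} {U : Set M}
    (hf : ∀ i ∈ s, IsSmoothOn (f i) U) : IsSmoothOn (fun x => ∑ i ∈ s, f i x) U :=
  fun x hx => ContMDiffWithinAt.sum fun i hi => hf i hi x hx

theorem IsSmoothOn.prod {ι : Type} (s : Finset ι) {f : ι → M → ℝ} {U : Set M}
    (hf : ∀ i ∈ s, IsSmoothOn (f i) U) : IsSmoothOn (fun x => ∏ i ∈ s, f i x) U :=
  fun x hx => ContMDiffWithinAt.prod fun i hi => hf i hi x hx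

theorem LorentzianMetric.isSmoothOn_inner (g : LorentzianMetric M) {U : Set M}
    {V W : (x : M) → TangentSpace (𝓡 3) x} (hV : IsSmoothFieldOn V U) (hW : IsSmoothFieldOn W U) :
    IsSmoothOn (fun x => g.inner x (V x) (W x)) U := by
  intro x hx
  have : ContMDiffWithinAt (𝓡 3) ((𝓡 3).prod 𝓘(ℝ)) ∞
      (fun m ↦ TotalSpace.mk' ℝ (E := Bundle.Trivial M ℝ) m (g.inner m (V m) (W m))) U x := by
    apply ContMDiffWithinAt.clm_bundle_apply₂ (F₁ := EuclideanSpace ℝ (Fin 3))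
      (F₂ := EuclideanSpace ℝ (Fin 3))
    · exact g.contMDiff.contMDiffAt.contMDiffWithinAt
    · exact hV x hx
    · exact hW x hx
  simp only [contMDiffWithinAt_totalSpace] at this
  exact this.2

theorem IsSmoothFieldOn.mlieBracket {U : Set M} (hU : IsOpen U)
    {V W : (x : M) → TangentSpace (𝓡 3) x} (hV : IsSmoothFieldOn V U) (hW : IsSmoothFieldOn W U) :
    IsSmoothFieldOn (VectorField.mlieBracket (𝓡 3) V W) U := fun _ hx =>
  ContMDiffAt.contMDiffWithinAt <| ContMDiffAt.mlieBracket_vectorField (m := ⊤) (n := ⊤)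
    (hV.contMDiffAt (hU.mem_nhds hx)) (hW.contMDiffAt (hU.mem_nhds hx)) (by simp)

theorem etaInv_mul_eta (a c : Fin 3) : ∑ b, etaInv a b * eta b c = if a = c then 1 else 0 := by
  fin_cases a <;> fin_cases c <;> simp [etaInv, eta, Fin.sum_univ_three]

theorem eta_mul_etaInv (a c : Fin 3) : ∑ b, eta a b * etaInv b c = if a = c then 1 else 0 := by
  fin_cases a <;> fin_cases c <;> simp [etaInv, eta, Fin.sum_univ_three]

theorem eta_symm (a b : Fin 3) : eta a b = eta b a := by
  fin_cases a <;> fin_cases b <;> simp [eta]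

namespace MovingFrame

/-! ### Calculus in a moving frame -/

section frameDeriv

variable (e : MovingFrame g) (a : Fin 3) {x : M}

theorem frameDeriv_eq (f : M → ℝ) : e.frameDeriv a f x = mvfderiv (𝓡 3) f x (e.vec a x) := rfl

theorem frameDeriv_const (c : ℝ) : e.frameDeriv a (fun _ => c) x = 0 := by
  rw [frameDeriv_eq, mvfderiv_const]; rfl

theorem frameDeriv_add {f f' : M → ℝ} (hf : IsDiffAt f x) (hf' : IsDiffAt f' x) :
    e.frameDeriv a (fun y => f y + f' y) x = e.frameDeriv a f x + e.frameDeriv a f' x := by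
  simp only [frameDeriv_eq]; rw [mvfderiv_fun_add hf hf']; rfl

theorem frameDeriv_sub {f f' : M → ℝ} (hf : IsDiffAt f x) (hf' : IsDiffAt f' x) :
    e.frameDeriv a (fun y => f y - f' y) x = e.frameDeriv a f x - e.frameDeriv a f' x := by
  simp only [frameDeriv_eq]; rw [mvfderiv_fun_sub hf hf']; rfl

theorem frameDeriv_mul {f f' : M → ℝ} (hf : IsDiffAt f x) (hf' : IsDiffAt f' x) :
    e.frameDeriv a (fun y => f y * f' y) x
      = e.frameDeriv a f x * f' x + f x * e.frameDeriv a f' x := by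
  simp only [frameDeriv_eq]; rw [mvfderiv_fun_mul hf hf']
  simp only [add_apply, smul_apply, smul_eq_mul]
  ring

theorem frameDeriv_const_mul {f : M → ℝ} (c : ℝ) (hf : IsDiffAt f x) :
    e.frameDeriv a (fun y => c * f y) x = c * e.frameDeriv a f x := by
  rw [e.frameDeriv_mul a mdifferentiableAt_const hf, frameDeriv_const]; ring

theorem frameDeriv_sum {ι : Type} (s : Finset ι) {f : ι → M → ℝ} (hf : ∀ i ∈ s, IsDiffAt (f i) x) :
    e.frameDeriv a (fun y => ∑ i ∈ s, f i y) x = ∑ i ∈ s, e.frameDeriv a (f i) x := by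
  have h : mvfderiv (𝓡 3) (∑ i ∈ s, f i) x = ∑ i ∈ s, mvfderiv (𝓡 3) (f i) x :=
    (HasMFDerivAt.sum fun i hi => (hf i hi).hasMFDerivAt).mfderiv
  have h' : (∑ i ∈ s, f i) = fun y => ∑ i ∈ s, f i y := by ext y; simp
  rw [h'] at h
  simp only [frameDeriv_eq, h]
  exact sum_apply _ _ _

theorem frameDeriv_prod {ι : Type} [DecidableEq ι] (s : Finset ι) {f : ι → M → ℝ}
    (hf : ∀ i ∈ s, IsDiffAt (f i) x) :
    e.frameDeriv a (fun y => ∏ i ∈ s, f i y) x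
      = ∑ i ∈ s, (∏ j ∈ s.erase i, f j x) * e.frameDeriv a (f i) x := by
  have h := (HasMFDerivAt.prod fun i hi => (hf i hi).hasMFDerivAt).mfderiv
  have h' : (∏ i ∈ s, f i) = fun y => ∏ i ∈ s, f i y := by ext y; simp
  rw [h'] at h
  unfold frameDeriv
  rw [h]
  exact sum_apply _ _ _

theorem frameDeriv_congr {f f' : M → ℝ} {U : Set M} (hU : IsOpen U) (hx : x ∈ U)
    (h : ∀ y ∈ U, f y = f' y) : e.frameDeriv a f x = e.frameDeriv a f' x := by
  unfold frameDeriv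
  rw [(Filter.eventuallyEq_of_mem (hU.mem_nhds hx) h).mfderiv_eq,
    h x hx]

end frameDeriv

variable (e : MovingFrame g)

theorem inner_sum_vec {x : M} (hx : x ∈ e.domain) (c : Fin 3 → ℝ) (b : Fin 3) :
    g.inner x (∑ a, c a • e.vec a x) (e.vec b x) = ∑ a, c a * eta a b := by
  simp [map_sum, e.inner_eq x hx]

theorem linearIndependent {x : M} (hx : x ∈ e.domain) :
    LinearIndependent ℝ (fun a => e.vec a x) := by
  rw [Fintype.linearIndependent_iff]
  intro c hc
  have h := fun b => e.inner_sum_vec hx c b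
  rw [hc] at h
  simp only [map_zero, zero_apply, Fin.sum_univ_three, eta] at h
  have h0 := h 0
  have h1 := h 1
  have h2 := h 2
  simp at h0 h1 h2
  intro i
  fin_cases i <;> simpa

theorem eq_sum_vec {x : M} (hx : x ∈ e.domain) (v : TangentSpace (𝓡 3) x) :
    v = ∑ a, (∑ b, etaInv a b * g.inner x v (e.vec b x)) • e.vec a x := by
  have hcard : Fintype.card (Fin 3) = Module.finrank ℝ (TangentSpace (𝓡 3) x) :=
    (finrank_euclideanSpace_fin (𝕜 := ℝ) (n := 3)).symm
  let B := basisOfLinearIndependentOfCardEqFinrank (e.linearIndependent hx) hcard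
  have hB : ∀ a, B a = e.vec a x := fun a => by simp [B]
  have hv : v = ∑ a, B.repr v a • e.vec a x := by
    conv_lhs => rw [← B.sum_repr v]
    simp [hB]
  have hin : ∀ b, g.inner x v (e.vec b x) = ∑ a, B.repr v a * eta a b := fun b => by
    conv_lhs => rw [hv]
    exact e.inner_sum_vec hx _ b
  conv_lhs => rw [hv]
  refine Finset.sum_congr rfl fun a _ => ?_
  congr 1
  simp only [hin, Fin.sum_univ_three]
  fin_cases a <;> (simp [etaInv, eta]; try ring)

theorem coeff_eq_of_sum_eq {x : M} (hx : x ∈ e.domain) {c c' : Fin 3 → ℝ}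
    (h : ∑ a, c a • e.vec a x = ∑ a, c' a • e.vec a x) : c = c' := by
  have h0 : ∑ a, (c a - c' a) • e.vec a x = 0 := by
    simp only [sub_smul, Finset.sum_sub_distrib, h, sub_self]
  funext a
  exact sub_eq_zero.mp (Fintype.linearIndependent_iff.mp (e.linearIndependent hx) _ h0 a)

theorem mlieBracket_eq {x : M} (hx : x ∈ e.domain) (a b : Fin 3) :
    VectorField.mlieBracket (𝓡 3) (e.vec a) (e.vec b) x
      = ∑ f, e.bracketCoeff f a b x • e.vec f x :=
  e.eq_sum_vec hx _

/-! ### Smoothness of the frame components -/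

theorem isSmoothOn_bracketLow (a b c : Fin 3) : IsSmoothOn (e.bracketLow a b c) e.domain :=
  g.isSmoothOn_inner ((IsSmoothFieldOn.mlieBracket e.isOpen_domain (e.smooth a) (e.smooth b)))
    (e.smooth c)

theorem isSmoothOn_bracketCoeff (f a b : Fin 3) : IsSmoothOn (e.bracketCoeff f a b) e.domain :=
  IsSmoothOn.sum _ fun h _ => (e.isSmoothOn_bracketLow a b h).const_mul _

theorem isSmoothOn_connLow (a b c : Fin 3) : IsSmoothOn (e.connLow a b c) e.domain := by
  have := (((e.isSmoothOn_bracketLow c b a).sub (e.isSmoothOn_bracketLow b a c)).add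
    (e.isSmoothOn_bracketLow a c b)).const_mul 2⁻¹
  refine this.congr fun x _ => ?_
  simp only [connLow]; ring

theorem isSmoothOn_conn (a b c : Fin 3) : IsSmoothOn (e.conn a b c) e.domain :=
  IsSmoothOn.sum _ fun h _ => (e.isSmoothOn_connLow h b c).const_mul _

theorem mlieBracket_smul {f : M → ℝ} {x : M} (hx : x ∈ e.domain) (hf : IsDiffAt f x)
    (V : (x : M) → TangentSpace (𝓡 3) x) (b : Fin 3) :
    VectorField.mlieBracket (𝓡 3) V (f • e.vec b) x
      = mvfderiv (𝓡 3) f x (V x) • e.vec b x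
        + f x • VectorField.mlieBracket (𝓡 3) V (e.vec b) x :=
  VectorField.mlieBracket_smul_right hf
    (IsSmoothFieldOn.mdifferentiableAt (e.smooth b) e.isOpen_domain hx)

/-- Brackets of smooth fields are smooth, and `e_a(f)` can be read off from `[e_a, f e₁] = e_a(f) e₁
+ f [e_a, e₁]` by pairing with `e₁`. The factor 2 below is the inverse of `η₁₁`. -/
theorem isSmoothOn_frameDeriv (a : Fin 3) {f : M → ℝ} {U : Set M} (hU : IsOpen U)
    (hUe : U ⊆ e.domain) (hf : IsSmoothOn f U) : IsSmoothOn (e.frameDeriv a f) U := by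
  have h1 : IsSmoothFieldOn (e.vec 1) U := ContMDiffOn.mono (e.smooth 1) hUe
  have hfe : IsSmoothFieldOn (f • e.vec 1) U := ContMDiffOn.smul_section hf h1
  have ha : IsSmoothFieldOn (e.vec a) U := ContMDiffOn.mono (e.smooth a) hUe
  have hbr := g.isSmoothOn_inner (IsSmoothFieldOn.mlieBracket hU ha hfe) h1
  have hlow : IsSmoothOn (e.bracketLow a 1 1) U := (e.isSmoothOn_bracketLow a 1 1).mono hUe
  refine ((hbr.sub (hf.mul hlow)).const_mul 2).congr fun x hx => ?_
  have := congrArg (fun v => g.inner x v (e.vec 1 x))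
    (e.mlieBracket_smul (hUe hx) (hf.isDiffAt hU hx) (e.vec a) 1)
  simp only [map_add, map_smul, add_apply, smul_apply, smul_eq_mul,
    e.inner_eq x (hUe hx)] at this
  rw [this, bracketLow, frameDeriv_eq, show eta 1 1 = 1 / 2 by simp [eta]]
  ring

theorem isSmoothOn_riemannUp (a b c d : Fin 3) : IsSmoothOn (e.riemannUp a b c d) e.domain := by
  have hD := fun i a b c => e.isSmoothOn_frameDeriv i e.isOpen_domain le_rfl
    (e.isSmoothOn_conn a b c)
  exact (((hD c a b d).sub (hD d a b c)).add (IsSmoothOn.sum _ fun f _ =>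
    ((e.isSmoothOn_conn a f c).mul (e.isSmoothOn_conn f b d)).sub
      ((e.isSmoothOn_conn a f d).mul (e.isSmoothOn_conn f b c)))).sub
    (IsSmoothOn.sum _ fun f _ => (e.isSmoothOn_bracketCoeff f c d).mul (e.isSmoothOn_conn a b f))

theorem isSmoothOn_riemann (a b c d : Fin 3) : IsSmoothOn (e.riemann a b c d) e.domain :=
  IsSmoothOn.sum _ fun f _ => (e.isSmoothOn_riemannUp f b c d).const_mul _

theorem isSmoothOn_covDeriv {k : ℕ} {T : M → Tensor k}
    (hT : ∀ a, IsSmoothOn (fun x => T x a) e.domain) (a : Fin (k + 1) → Fin 3) :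
    IsSmoothOn (fun x => e.covDeriv T x a) e.domain :=
  (e.isSmoothOn_frameDeriv _ e.isOpen_domain le_rfl (hT _)).sub
    (IsSmoothOn.sum _ fun _ _ => IsSmoothOn.sum _ fun _ _ => (e.isSmoothOn_conn _ _ _).mul (hT _))

theorem isSmoothOn_curvatureDeriv (k : ℕ) (a : Fin (4 + k) → Fin 3) :
    IsSmoothOn (fun x => e.curvatureDeriv k x a) e.domain := by
  induction k with
  | zero => exact e.isSmoothOn_riemann _ _ _ _
  | succ k ih => exact e.isSmoothOn_covDeriv ih a

theorem mdifferentiableAt_curvatureJet (p : ℕ) {x : M} (hx : x ∈ e.domain) :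
    MDifferentiableAt (𝓡 3) 𝓘(ℝ, CurvatureSpace p) (e.curvatureJet p) x := by
  have : ContMDiffOn (𝓡 3) 𝓘(ℝ, CurvatureSpace p) ∞ (e.curvatureJet p) e.domain :=
    contMDiffOn_pi_space.mpr fun k => contMDiffOn_pi_space.mpr fun a =>
      e.isSmoothOn_curvatureDeriv k a
  exact (this.contMDiffAt (e.isOpen_domain.mem_nhds hx)).mdifferentiableAt (by simp)

end MovingFrame

namespace MovingFrame

variable (e : MovingFrame g)

/-! ### Brackets, Jacobi identity and commutators -/

theorem bracketLow_antisymm (a b c : Fin 3) (x : M) :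
    e.bracketLow a b c x = -e.bracketLow b a c x := by
  unfold bracketLow
  rw [VectorField.mlieBracket_swap_apply]
  simp

theorem connLow_antisymm (a b c : Fin 3) (x : M) : e.connLow a b c x = -e.connLow b a c x := by
  unfold connLow
  rw [e.bracketLow_antisymm c b a, e.bracketLow_antisymm b a c, e.bracketLow_antisymm a c b]
  ring

theorem bracketLow_eq_connLow (a b c : Fin 3) (x : M) :
    e.bracketLow a b c x = e.connLow c b a x - e.connLow c a b x := by
  unfold connLow
  rw [e.bracketLow_antisymm c b a, e.bracketLow_antisymm b a c, e.bracketLow_antisymm a c b]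
  ring

theorem bracketCoeff_eq_conn (f a b : Fin 3) (x : M) :
    e.bracketCoeff f a b x = e.conn f b a x - e.conn f a b x := by
  simp only [bracketCoeff, conn, ← Finset.sum_sub_distrib, bracketLow_eq_connLow, mul_sub]

/-- The connection components are determined by metricity and vanishing torsion. -/
theorem connLow_unique {x : M} {G : Fin 3 → Fin 3 → Fin 3 → ℝ} (hG : ∀ a b c, G a b c = -G b a c)
    (h : ∀ a b c, e.bracketLow a b c x = G c b a - G c a b) (a b c : Fin 3) :
    e.connLow a b c x = G a b c := by
  unfold connLow
  rw [h c b a, h b a c, h a c b, hG b a c, hG c a b, hG c b a]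
  ring

theorem connLow_eq_sum (a b c : Fin 3) (x : M) :
    e.connLow a b c x = ∑ f, eta a f * e.conn f b c x := by
  simp only [conn, Fin.sum_univ_three]
  fin_cases a <;> simp [eta, etaInv]

theorem mdifferentiableAt_vec {x : M} (hx : x ∈ e.domain) (a : Fin 3) :
    MDifferentiableAt (𝓡 3) (𝓡 3).tangent (fun x => (⟨x, e.vec a x⟩ : TangentBundle (𝓡 3) M)) x :=
  IsSmoothFieldOn.mdifferentiableAt (e.smooth a) e.isOpen_domain hx

theorem mlieBracket_sum_smul {x : M} (hx : x ∈ e.domain) {c : Fin 3 → M → ℝ}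
    (hc : ∀ f, IsDiffAt (c f) x) (V : (x : M) → TangentSpace (𝓡 3) x) :
    VectorField.mlieBracket (𝓡 3) V (fun y => ∑ f, c f y • e.vec f y) x
      = ∑ f, (mvfderiv (𝓡 3) (c f) x (V x) • e.vec f x
          + c f x • VectorField.mlieBracket (𝓡 3) V (e.vec f) x) := by
  have hd : ∀ f, MDifferentiableAt (𝓡 3) (𝓡 3).tangent
      (fun x => (⟨x, (c f • e.vec f) x⟩ : TangentBundle (𝓡 3) M)) x := fun f =>
    MDifferentiableAt.smul_section (hc f) (e.mdifferentiableAt_vec hx f)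
  have hs : (fun y => ∑ f, c f y • e.vec f y)
      = c 0 • e.vec 0 + c 1 • e.vec 1 + c 2 • e.vec 2 := by
    ext1 y; simp [Fin.sum_univ_three]
  rw [hs, VectorField.mlieBracket_add_right (mdifferentiableAt_add_section (hd 0) (hd 1)) (hd 2),
    VectorField.mlieBracket_add_right (hd 0) (hd 1)]
  simp only [Fin.sum_univ_three, e.mlieBracket_smul hx (hc _)]

theorem mlieBracket_mlieBracket {x : M} (hx : x ∈ e.domain) (V : (x : M) → TangentSpace (𝓡 3) x)
    (b c : Fin 3) :
    VectorField.mlieBracket (𝓡 3) V (VectorField.mlieBracket (𝓡 3) (e.vec b) (e.vec c)) x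
      = ∑ f, (mvfderiv (𝓡 3) (e.bracketCoeff f b c) x (V x) • e.vec f x
          + e.bracketCoeff f b c x • VectorField.mlieBracket (𝓡 3) V (e.vec f) x) := by
  rw [← e.mlieBracket_sum_smul hx fun f =>
    (e.isSmoothOn_bracketCoeff f b c).isDiffAt e.isOpen_domain hx]
  exact Filter.EventuallyEq.mlieBracket_vectorField_eq Filter.EventuallyEq.rfl
    (Filter.eventuallyEq_of_mem (e.isOpen_domain.mem_nhds hx) fun y hy => e.mlieBracket_eq hy b c)

theorem leibniz_identity {x : M} {U : Set M} (hU : IsOpen U) (hx : x ∈ U)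
    {V W Z : (x : M) → TangentSpace (𝓡 3) x} (hV : IsSmoothFieldOn V U) (hW : IsSmoothFieldOn W U)
    (hZ : IsSmoothFieldOn Z U) :
    VectorField.mlieBracket (𝓡 3) V (VectorField.mlieBracket (𝓡 3) W Z) x
      = VectorField.mlieBracket (𝓡 3) (VectorField.mlieBracket (𝓡 3) V W) Z x
        + VectorField.mlieBracket (𝓡 3) W (VectorField.mlieBracket (𝓡 3) V Z) x := by
  have h2 : minSmoothness ℝ 2 ≤ ∞ := by
    rw [minSmoothness_of_isRCLikeNormedField]; exact WithTop.coe_le_coe.mpr le_top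
  exact VectorField.leibniz_identity_mlieBracket_apply
    ((hV.contMDiffAt (hU.mem_nhds hx)).of_le h2) ((hW.contMDiffAt (hU.mem_nhds hx)).of_le h2)
    ((hZ.contMDiffAt (hU.mem_nhds hx)).of_le h2)

theorem jacobi {x : M} (hx : x ∈ e.domain) (a b c h : Fin 3) :
    (e.frameDeriv a (e.bracketCoeff h b c) x
        + ∑ f, e.bracketCoeff f b c x * e.bracketCoeff h a f x)
      + (e.frameDeriv b (e.bracketCoeff h c a) x
        + ∑ f, e.bracketCoeff f c a x * e.bracketCoeff h b f x)
      + (e.frameDeriv c (e.bracketCoeff h a b) x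
        + ∑ f, e.bracketCoeff f a b x * e.bracketCoeff h c f x) = 0 := by
  have key : ∀ a b c, VectorField.mlieBracket (𝓡 3) (e.vec a)
      (VectorField.mlieBracket (𝓡 3) (e.vec b) (e.vec c)) x
      = ∑ h, (e.frameDeriv a (e.bracketCoeff h b c) x
          + ∑ f, e.bracketCoeff f b c x * e.bracketCoeff h a f x) • e.vec h x := by
    intro a b c
    rw [e.mlieBracket_mlieBracket hx]
    simp only [e.mlieBracket_eq hx, add_smul, Finset.sum_add_distrib, ← frameDeriv_eq,
      Finset.smul_sum, Finset.sum_smul, smul_smul]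
    rw [Finset.sum_comm (γ := Fin 3)]
  -- The Leibniz form of the Jacobi identity is brought to cyclic form by swapping two brackets,
  -- after which each term is an instance of `key`.
  have hJ := leibniz_identity e.isOpen_domain hx (e.smooth a) (e.smooth b) (e.smooth c)
  rw [VectorField.mlieBracket_swap_apply (W := e.vec c),
    VectorField.mlieBracket_swap (V := e.vec a) (W := e.vec c),
    ← neg_one_smul ℝ (VectorField.mlieBracket (𝓡 3) (e.vec c) (e.vec a)),
    VectorField.mlieBracket_const_smul_right (IsSmoothFieldOn.mdifferentiableAt
      (IsSmoothFieldOn.mlieBracket e.isOpen_domain (e.smooth c) (e.smooth a)) e.isOpen_domain hx),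
    key, key, key, neg_one_smul, ← sub_eq_zero] at hJ
  have h0 := e.coeff_eq_of_sum_eq hx (c := fun h =>
      (e.frameDeriv a (e.bracketCoeff h b c) x
        + ∑ f, e.bracketCoeff f b c x * e.bracketCoeff h a f x)
      + (e.frameDeriv b (e.bracketCoeff h c a) x
        + ∑ f, e.bracketCoeff f c a x * e.bracketCoeff h b f x)
      + (e.frameDeriv c (e.bracketCoeff h a b) x
        + ∑ f, e.bracketCoeff f a b x * e.bracketCoeff h c f x)) (c' := 0) (by
    simp only [add_smul _ _ (e.vec _ x), Finset.sum_add_distrib] at hJ ⊢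
    simp only [Pi.zero_apply, zero_smul, Finset.sum_const_zero]
    refine Eq.trans ?_ hJ
    abel)
  exact congrFun h0 h

/-- The commutator of frame derivatives. -/
theorem frameDeriv_comm {U : Set M} (hU : IsOpen U) (hUe : U ⊆ e.domain) {x : M} (hx : x ∈ U)
    {f : M → ℝ} (hf : IsSmoothOn f U) (a b : Fin 3) :
    e.frameDeriv a (e.frameDeriv b f) x - e.frameDeriv b (e.frameDeriv a f) x
      = ∑ h, e.bracketCoeff h a b x * e.frameDeriv h f x := by
  have hv : ∀ a, IsSmoothFieldOn (e.vec a) U := fun a => ContMDiffOn.mono (e.smooth a) hUe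
  have hfd := hf.isDiffAt hU hx
  -- Second derivatives of `f` enter as coefficients of `e₁` in the Jacobi identity for `e_a, e_b, f
  -- e₁`; the terms multiplied by `f` itself cancel by the identity for `e_a, e_b, e₁`.
  have hJ := leibniz_identity hU hx (hv a) (hv b) (ContMDiffOn.smul_section hf (hv 1))
  have hJ' := leibniz_identity hU hx (hv a) (hv b) (hv 1)
  have key : ∀ a b, VectorField.mlieBracket (𝓡 3) (e.vec a)
      (VectorField.mlieBracket (𝓡 3) (e.vec b) (f • e.vec 1)) x
      = e.frameDeriv a (e.frameDeriv b f) x • e.vec 1 x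
        + e.frameDeriv b f x • VectorField.mlieBracket (𝓡 3) (e.vec a) (e.vec 1) x
        + (e.frameDeriv a f x • VectorField.mlieBracket (𝓡 3) (e.vec b) (e.vec 1) x
        + f x • VectorField.mlieBracket (𝓡 3) (e.vec a)
            (VectorField.mlieBracket (𝓡 3) (e.vec b) (e.vec 1)) x) := by
    intro a b
    have hcongr : VectorField.mlieBracket (𝓡 3) (e.vec b) (f • e.vec 1) =ᶠ[nhds x]
        e.frameDeriv b f • e.vec 1 + f • VectorField.mlieBracket (𝓡 3) (e.vec b) (e.vec 1) :=
      Filter.eventuallyEq_of_mem (hU.mem_nhds hx) fun y hy =>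
        e.mlieBracket_smul (hUe hy) (hf.isDiffAt hU hy) (e.vec b) 1
    have hD := (e.isSmoothOn_frameDeriv b hU hUe hf).isDiffAt hU hx
    have hB := IsSmoothFieldOn.mdifferentiableAt
      (IsSmoothFieldOn.mlieBracket hU (hv b) (hv 1)) hU hx
    refine (Filter.EventuallyEq.mlieBracket_vectorField_eq
      (V₁ := e.vec a) (V := e.vec a) Filter.EventuallyEq.rfl hcongr).trans ?_
    rw [VectorField.mlieBracket_add_right
        (MDifferentiableAt.smul_section hD (e.mdifferentiableAt_vec (hUe hx) 1))
        (MDifferentiableAt.smul_section hfd hB),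
      e.mlieBracket_smul (hUe hx) hD, VectorField.mlieBracket_smul_right hfd hB]
    rfl
  rw [key, key, e.mlieBracket_smul (hUe hx) hfd, hJ', e.mlieBracket_eq (hUe hx) a b] at hJ
  simp only [map_sum, map_smul, smul_eq_mul, ← frameDeriv_eq] at hJ
  have h0 : (e.frameDeriv a (e.frameDeriv b f) x - e.frameDeriv b (e.frameDeriv a f) x
      - ∑ h, e.bracketCoeff h a b x * e.frameDeriv h f x) • e.vec 1 x = 0 := by
    rw [← sub_eq_zero] at hJ
    rw [← hJ]
    module
  have h1 := congrArg (fun v => g.inner x v (e.vec 1 x)) h0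
  simp only [map_smul, smul_apply, smul_eq_mul, e.inner_eq x (hUe hx), map_zero,
    zero_apply] at h1
  have : eta 1 1 = 1 / 2 := by simp [eta]
  rw [this] at h1
  linarith

end MovingFrame

/-! ### Sums over multi-indices -/

theorem sum_cons {k : ℕ} (F : (Fin (k + 1) → Fin 3) → ℝ) :
    ∑ b, F b = ∑ c : Fin 3, ∑ b : Fin k → Fin 3, F (Fin.cons c b) := by
  rw [← (Fin.consEquiv fun _ : Fin (k + 1) => Fin 3).sum_comp, Fintype.sum_prod_type]
  rfl

theorem sum_snoc {k : ℕ} (F : (Fin (k + 1) → Fin 3) → ℝ) :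
    ∑ b, F b = ∑ c : Fin 3, ∑ b : Fin k → Fin 3, F (Fin.snoc b c) := by
  rw [← (Fin.snocEquiv fun _ : Fin (k + 1) => Fin 3).sum_comp, Fintype.sum_prod_type]
  rfl

/-- Exchanging the `i`th entry of `b` with `m` is an involution of the index set. It relabels the
contracted index in the connection terms of a covariant derivative. -/
theorem sum_update_swap {k : ℕ} (i : Fin k) (F : (Fin k → Fin 3) → Fin 3 → ℝ) :
    ∑ b, ∑ m, F b m = ∑ b, ∑ m, F (Function.update b i m) (b i) := by
  let σ : (Fin k → Fin 3) × Fin 3 → (Fin k → Fin 3) × Fin 3 := fun p =>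
    (Function.update p.1 i p.2, p.1 i)
  have hσ : Function.Involutive σ := fun p => by simp [σ]
  rw [← Fintype.sum_prod_type', ← Fintype.sum_prod_type', ← Equiv.sum_comp hσ.toPerm]
  rfl

/-- The action on covariant tensors `T ↦ T(X ·, …, X ·)`. -/
def pull (X : Fin 3 → Fin 3 → ℝ) {k : ℕ} (T : Tensor k) : Tensor k := fun a =>
  ∑ b : Fin k → Fin 3, (∏ i, X (b i) (a i)) * T b

theorem pull_snoc (X : Fin 3 → Fin 3 → ℝ) {k : ℕ} (T : Tensor (k + 1)) (a : Fin (k + 1) → Fin 3) :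
    pull X T a = ∑ b : Fin k → Fin 3, (∏ i, X (b i) (Fin.init a i)) *
      ∑ c, X c (a (Fin.last k)) * T (Fin.snoc b c) := by
  unfold pull
  rw [sum_snoc, Finset.sum_comm]
  refine Finset.sum_congr rfl fun b _ => ?_
  rw [Finset.mul_sum]
  refine Finset.sum_congr rfl fun c _ => ?_
  rw [Fin.prod_univ_castSucc]
  simp [Fin.init, mul_assoc]

theorem pull_four (X : Fin 3 → Fin 3 → ℝ) (T : Fin 3 → Fin 3 → Fin 3 → Fin 3 → ℝ)
    (a : Fin 4 → Fin 3) :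
    pull X (k := 4) (fun b => T (b 0) (b 1) (b 2) (b 3)) a
      = ∑ p, ∑ q, ∑ r, ∑ s, X p (a 0) * X q (a 1) * X r (a 2) * X s (a 3) * T p q r s := by
  unfold pull
  rw [sum_cons]
  refine Finset.sum_congr rfl fun p _ => ?_
  rw [sum_cons]
  refine Finset.sum_congr rfl fun q _ => ?_
  rw [sum_cons]
  refine Finset.sum_congr rfl fun r _ => ?_
  rw [sum_cons]
  refine Finset.sum_congr rfl fun s _ => ?_
  rw [Fintype.sum_unique, Fin.prod_univ_four]
  rfl

namespace MovingFrame

variable (e h : MovingFrame g)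

/-! ### Change of frame -/

/-- The components `X^b_a` of the vectors of the frame `e` relative to the frame `h`. -/
def transition (b a : Fin 3) (x : M) : ℝ := ∑ c, etaInv b c * g.inner x (e.vec a x) (h.vec c x)

variable {x : M}

theorem vec_eq_sum_transition (hx : x ∈ h.domain) (a : Fin 3) :
    e.vec a x = ∑ b, e.transition h b a x • h.vec b x := h.eq_sum_vec hx _

theorem isSmoothOn_transition (b a : Fin 3) :
    IsSmoothOn (e.transition h b a) (e.domain ∩ h.domain) :=
  IsSmoothOn.sum _ fun c _ => (g.isSmoothOn_inner
    (ContMDiffOn.mono (e.smooth a) Set.inter_subset_left)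
    (ContMDiffOn.mono (h.smooth c) Set.inter_subset_right)).const_mul _

theorem isOpen_inter_domain : IsOpen (e.domain ∩ h.domain) := e.isOpen_domain.inter h.isOpen_domain

theorem isDiffAt_transition (hx : x ∈ e.domain ∩ h.domain) (b a : Fin 3) :
    IsDiffAt (e.transition h b a) x :=
  (e.isSmoothOn_transition h b a).isDiffAt (e.isOpen_inter_domain h) hx

theorem frameDeriv_eq_sum_transition (hx : x ∈ h.domain) (a : Fin 3) (f : M → ℝ) :
    e.frameDeriv a f x = ∑ b, e.transition h b a x * h.frameDeriv b f x := by
  simp only [frameDeriv_eq]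
  rw [e.vec_eq_sum_transition h hx a]
  simp

theorem sum_transition_eta (hx : x ∈ e.domain ∩ h.domain) (a b : Fin 3) :
    ∑ p, ∑ q, eta p q * e.transition h p a x * e.transition h q b x = eta a b := by
  rw [← e.inner_eq x hx.1 a b, e.vec_eq_sum_transition h hx.2 a, e.vec_eq_sum_transition h hx.2 b]
  simp [h.inner_eq x hx.2, Fin.sum_univ_three]
  ring

/-- Differentiating `Xᵀ η X = η`. This yields the metricity of the transformed connection. -/
theorem sum_frameDeriv_transition_eta (hx : x ∈ e.domain ∩ h.domain) (a b c : Fin 3) :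
    ∑ p, ∑ q, eta p q * (e.frameDeriv c (e.transition h p a) x * e.transition h q b x
      + e.transition h p a x * e.frameDeriv c (e.transition h q b) x) = 0 := by
  have hd := e.isDiffAt_transition h hx
  have hd2 : ∀ p q, IsDiffAt (fun y => e.transition h p a y * e.transition h q b y) x :=
    fun p q => (hd p a).mul (hd q b)
  have hd3 : ∀ p q, IsDiffAt (fun y => eta p q * (e.transition h p a y * e.transition h q b y)) x :=
    fun p q => MDifferentiableAt.mul mdifferentiableAt_const (hd2 p q)
  have h1 := e.frameDeriv_congr c (f := fun y => ∑ p, ∑ q, eta p q *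
    (e.transition h p a y * e.transition h q b y)) (f' := fun _ => eta a b)
    (e.isOpen_inter_domain h) hx fun y hy => by
      rw [← e.sum_transition_eta h hy a b]
      simp only [mul_assoc]
  rw [frameDeriv_const, frameDeriv_sum] at h1
  · rw [← h1]
    refine Finset.sum_congr rfl fun p _ => ?_
    rw [frameDeriv_sum _ _ _ fun q _ => hd3 p q]
    refine Finset.sum_congr rfl fun q _ => ?_
    rw [frameDeriv_const_mul _ _ _ (hd2 p q), frameDeriv_mul _ _ (hd p a) (hd q b)]
  · intro p _
    have := MDifferentiableAt.sum (t := Finset.univ) fun q _ => hd3 p q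
    convert this using 1
    ext y; simp

/-- The transition matrix. -/
def transitionMatrix (x : M) : Matrix (Fin 3) (Fin 3) ℝ := fun b a => e.transition h b a x

theorem transitionMatrix_eta (hx : x ∈ e.domain ∩ h.domain) :
    (e.transitionMatrix h x)ᵀ * eta * e.transitionMatrix h x = eta := by
  ext a b
  rw [← e.sum_transition_eta h hx a b]
  simp only [Matrix.mul_apply, Matrix.transpose_apply, transitionMatrix, Fin.sum_univ_three]
  ring

/-- Expansion of `[X^c_a h_c, X^d_b h_d]` by the Leibniz rule. This yields the vanishing torsion of
the transformed connection. -/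
theorem bracket_transition (hx : x ∈ e.domain ∩ h.domain) (a b k : Fin 3) :
    ∑ f, e.bracketCoeff f a b x * e.transition h k f x
      = e.frameDeriv a (e.transition h k b) x - e.frameDeriv b (e.transition h k a) x
        + ∑ c, ∑ d, e.transition h c a x * e.transition h d b x * h.bracketCoeff k c d x := by
  have hd := e.isDiffAt_transition h hx
  have hcongr : ∀ a, e.vec a =ᶠ[nhds x] fun y => ∑ d, e.transition h d a y • h.vec d y := fun a =>
    Filter.eventuallyEq_of_mem (h.isOpen_domain.mem_nhds hx.2) fun y hy =>
      e.vec_eq_sum_transition h hy a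
  have h1 : VectorField.mlieBracket (𝓡 3) (e.vec a) (e.vec b) x
      = ∑ d, (e.frameDeriv a (e.transition h d b) x • h.vec d x
          + e.transition h d b x • VectorField.mlieBracket (𝓡 3) (e.vec a) (h.vec d) x) :=
    (Filter.EventuallyEq.mlieBracket_vectorField_eq
      (V₁ := e.vec a) (V := e.vec a) Filter.EventuallyEq.rfl (hcongr b)).trans
      (h.mlieBracket_sum_smul hx.2 (fun d => hd d b) _)
  have h2 : ∀ d, VectorField.mlieBracket (𝓡 3) (e.vec a) (h.vec d) x
      = -∑ c, (h.frameDeriv d (e.transition h c a) x • h.vec c x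
          + e.transition h c a x • VectorField.mlieBracket (𝓡 3) (h.vec d) (h.vec c) x) := fun d => by
    rw [VectorField.mlieBracket_swap_apply]
    congr 1
    exact (Filter.EventuallyEq.mlieBracket_vectorField_eq
      (V₁ := h.vec d) (V := h.vec d) Filter.EventuallyEq.rfl (hcongr a)).trans
      (h.mlieBracket_sum_smul hx.2 (fun d => hd d a) _)
  have h3 : ∀ d c, VectorField.mlieBracket (𝓡 3) (h.vec d) (h.vec c) x
      = -∑ k, h.bracketCoeff k c d x • h.vec k x := fun d c => by
    rw [VectorField.mlieBracket_swap_apply, h.mlieBracket_eq hx.2]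
  rw [e.mlieBracket_eq hx.1] at h1
  simp only [h2, h3, e.vec_eq_sum_transition h hx.2] at h1
  have h4 := h.coeff_eq_of_sum_eq hx.2
    (c := fun k => ∑ f, e.bracketCoeff f a b x * e.transition h k f x)
    (c' := fun k => e.frameDeriv a (e.transition h k b) x
        - (∑ d, e.transition h d b x * h.frameDeriv d (e.transition h k a) x)
        + ∑ c, ∑ d, e.transition h c a x * e.transition h d b x * h.bracketCoeff k c d x) (by
      simp only [Fin.sum_univ_three] at h1 ⊢
      refine Eq.trans (Eq.trans ?_ h1) ?_ <;> module)
  rw [e.frameDeriv_eq_sum_transition h hx.2 b]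
  exact congrFun h4 k

end MovingFrame

/-! ### Transformation of the Levi-Civita connection -/

namespace MovingFrame

variable (e h : MovingFrame g) {x : M}

theorem bracketLow_eq_coeff (a b c : Fin 3) (x : M) :
    e.bracketLow a b c x = ∑ f, eta c f * e.bracketCoeff f a b x := by
  simp only [bracketCoeff, Fin.sum_univ_three]
  fin_cases c <;> simp [eta, etaInv]

theorem sum_eta_mul (F : Fin 3 → Fin 3 → ℝ) :
    ∑ p, ∑ q, eta p q * F p q = F 1 1 / 2 - F 0 2 - F 2 0 := by
  simp [Fin.sum_univ_three, eta]
  ring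

/-- `X^T η X = η` in the form `X η⁻¹ Xᵀ η = 1`. -/
theorem sum_transition_etaInv (hx : x ∈ e.domain ∩ h.domain) (k l : Fin 3) :
    ∑ p, ∑ q, etaInv p q * e.transition h k p x * e.transition h l q x = etaInv k l := by
  have h0 := e.transitionMatrix_eta h hx
  have hee : etaInv * eta = 1 := by
    ext i j; rw [Matrix.mul_apply, etaInv_mul_eta, Matrix.one_apply]
  have hee' : eta * etaInv = 1 := by
    ext i j; rw [Matrix.mul_apply, eta_mul_etaInv, Matrix.one_apply]
  set X := e.transitionMatrix h x with hX
  have h1 : (etaInv * Xᵀ * eta) * X = 1 := by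
    rw [Matrix.mul_assoc, Matrix.mul_assoc, ← Matrix.mul_assoc Xᵀ, h0, hee]
  have h2 : X * (etaInv * Xᵀ * eta) = 1 := mul_eq_one_comm.mp h1
  have h3 : X * etaInv * Xᵀ = etaInv := by
    calc X * etaInv * Xᵀ = X * (etaInv * Xᵀ * eta) * etaInv := by
          simp only [Matrix.mul_assoc, hee', Matrix.mul_one]
      _ = etaInv := by rw [h2, Matrix.one_mul]
  have h4 := congrFun (congrFun h3 k) l
  rw [← h4]
  simp only [Matrix.mul_apply, Matrix.transpose_apply, hX, transitionMatrix, Fin.sum_univ_three]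
  ring

/-- The components relative to `h` of `∇_{e_c} e_b`. -/
def nabla (b c l : Fin 3) (x : M) : ℝ :=
  e.frameDeriv c (e.transition h l b) x
    + ∑ f, (∑ p, h.conn l p f x * e.transition h p b x) * e.transition h f c x

/-- The right-hand side is metric and torsion-free, so uniqueness of such components identifies it
with the Koszul expression. -/
theorem connLow_transition (hx : x ∈ e.domain ∩ h.domain) (a b c : Fin 3) :
    e.connLow a b c x = ∑ k, ∑ l, eta k l * (e.transition h k a x * e.nabla h b c l x) := by
  refine e.connLow_unique
    (G := fun a b c => ∑ k, ∑ l, eta k l * (e.transition h k a x * e.nabla h b c l x)) ?_ ?_ a b c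
  · intro a b c
    have hD := e.sum_frameDeriv_transition_eta h hx a b c
    have hsym : ∀ p f, (∀ q, h.conn 0 q f x = -h.connLow 2 q f x) ∧
        (∀ q, h.conn 1 q f x = 2 * h.connLow 1 q f x) ∧
        (∀ q, h.conn 2 q f x = -h.connLow 0 q f x) ∧ h.connLow p p f x = 0 := by
      refine fun p f => ⟨fun q => ?_, fun q => ?_, fun q => ?_, ?_⟩
      iterate 3 simp [conn, Fin.sum_univ_three, etaInv]
      linarith [h.connLow_antisymm p p f x]
    rw [sum_eta_mul] at hD
    simp only [sum_eta_mul, nabla]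
    have h10 := h.connLow_antisymm 1 0
    have h20 := h.connLow_antisymm 2 0
    have h21 := h.connLow_antisymm 2 1
    have c0 := fun f => (hsym 0 f).1
    have c1 := fun f => (hsym 0 f).2.1
    have c2 := fun f => (hsym 0 f).2.2.1
    have z := fun p f => (hsym p f).2.2.2
    simp only [Fin.sum_univ_three, c0, c1, c2, z, h10, h20, h21]
    linear_combination hD
  · intro a b c
    have hb := fun k => e.bracket_transition h hx a b k
    have h1 : e.bracketLow a b c x = ∑ k, ∑ l, eta k l * (e.transition h k c x *
        ∑ f, e.bracketCoeff f a b x * e.transition h l f x) := by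
      have h2 := e.sum_transition_eta h hx c
      have h3 : e.bracketLow a b c x = ∑ f, (∑ p, ∑ q, eta p q * e.transition h p c x *
          e.transition h q f x) * e.bracketCoeff f a b x := by
        simp only [h2, e.bracketLow_eq_coeff]
      rw [h3]
      simp only [Fin.sum_univ_three]
      ring
    rw [h1]
    simp only [hb, h.bracketCoeff_eq_conn, sum_eta_mul, nabla]
    simp only [Fin.sum_univ_three]
    ring

/-- Both sides are the `h`-components of `∇_{e_c} e_b`. The free index is moved across with `X η⁻¹
Xᵀ = η⁻¹`. -/
theorem conn_transition (hx : x ∈ e.domain ∩ h.domain) (a b c : Fin 3) :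
    ∑ d, e.transition h a d x * e.conn d b c x = e.nabla h b c a x := by
  have hinv := e.sum_transition_etaInv h hx a
  calc ∑ d, e.transition h a d x * e.conn d b c x
      = ∑ k, (∑ p, ∑ q, etaInv p q * e.transition h a p x * e.transition h k q x) *
          ∑ l, eta k l * e.nabla h b c l x := by
        simp only [conn, e.connLow_transition h hx]
        simp only [Fin.sum_univ_three]
        ring
    _ = ∑ k, etaInv a k * ∑ l, eta k l * e.nabla h b c l x := by simp only [hinv]
    _ = e.nabla h b c a x := by
        simp only [Fin.sum_univ_three]
        fin_cases a <;> simp [eta, etaInv]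

end MovingFrame

/-! ### Transformation of the curvature and its covariant derivatives -/

namespace MovingFrame

variable (e h : MovingFrame g) {x : M}

theorem isDiffAt_conn (hx : x ∈ e.domain) (a b c : Fin 3) : IsDiffAt (e.conn a b c) x :=
  (e.isSmoothOn_conn a b c).isDiffAt e.isOpen_domain hx

/-- The connection matrices of `h` contracted with the vectors of `e`. -/
def connAlong (a b c : Fin 3) (x : M) : ℝ := ∑ f, e.transition h f c x * h.conn a b f x

theorem conn_transition' (hx : x ∈ e.domain ∩ h.domain) (a b c : Fin 3) :
    ∑ d, e.transition h a d x * e.conn d b c x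
      = (∑ p, e.connAlong h a p c x * e.transition h p b x)
        + e.frameDeriv c (e.transition h a b) x := by
  rw [e.conn_transition h hx, nabla]
  simp only [connAlong, Fin.sum_univ_three]
  ring

theorem frameDeriv_sum_mul (i : Fin 3) {F G : Fin 3 → M → ℝ} (hF : ∀ p, IsDiffAt (F p) x)
    (hG : ∀ p, IsDiffAt (G p) x) :
    e.frameDeriv i (fun y => ∑ p, F p y * G p y) x
      = ∑ p, (e.frameDeriv i (F p) x * G p x + F p x * e.frameDeriv i (G p) x) := by
  rw [e.frameDeriv_sum i _ (f := fun p y => F p y * G p y) fun p _ => (hF p).mul (hG p)]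
  exact Finset.sum_congr rfl fun p _ => frameDeriv_mul _ _ (hF p) (hG p)

theorem isSmoothOn_connAlong (a b c : Fin 3) :
    IsSmoothOn (e.connAlong h a b c) (e.domain ∩ h.domain) :=
  IsSmoothOn.sum _ fun f _ => (e.isSmoothOn_transition h f c).mul
    ((h.isSmoothOn_conn a b f).mono Set.inter_subset_right)

theorem frameDeriv_connAlong (hx : x ∈ e.domain ∩ h.domain) (a b c d : Fin 3) :
    e.frameDeriv d (e.connAlong h a b c) x
      = ∑ f, (e.frameDeriv d (e.transition h f c) x * h.conn a b f x
          + e.transition h f c x * ∑ q, e.transition h q d x * h.frameDeriv q (h.conn a b f) x) := by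
  refine (e.frameDeriv_sum_mul d (fun p => e.isDiffAt_transition h hx p c)
    fun p => h.isDiffAt_conn hx.2 a b p).trans ?_
  simp only [e.frameDeriv_eq_sum_transition h hx.2 d (h.conn _ _ _)]

/-- The derivative of the transformation law of the connection. -/
theorem frameDeriv_conn_transition (hx : x ∈ e.domain ∩ h.domain) (a b c d : Fin 3) :
    ∑ k, (e.frameDeriv c (e.transition h a k) x * e.conn k b d x
        + e.transition h a k x * e.frameDeriv c (e.conn k b d) x)
      = (∑ p, (e.frameDeriv c (e.connAlong h a p d) x * e.transition h p b x
          + e.connAlong h a p d x * e.frameDeriv c (e.transition h p b) x))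
        + e.frameDeriv c (e.frameDeriv d (e.transition h a b)) x := by
  have hU := e.isOpen_inter_domain h
  have hX := e.isDiffAt_transition h hx
  have hA := fun a b c => (e.isSmoothOn_connAlong h a b c).isDiffAt hU hx
  have h1 := e.frameDeriv_congr c hU hx
    (f := fun y => ∑ k, e.transition h a k y * e.conn k b d y)
    (f' := fun y => (∑ p, e.connAlong h a p d y * e.transition h p b y)
        + e.frameDeriv d (e.transition h a b) y)
    fun y hy => e.conn_transition' h hy a b d
  rw [e.frameDeriv_sum_mul c (fun k => hX a k) (fun k => e.isDiffAt_conn hx.1 k b d),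
    e.frameDeriv_add, e.frameDeriv_sum_mul c (fun p => hA a p d) (fun p => hX p b)] at h1
  · exact h1
  · exact (IsSmoothOn.sum _ fun p _ => (e.isSmoothOn_connAlong h a p d).mul
      (e.isSmoothOn_transition h p b)).isDiffAt hU hx
  · exact (e.isSmoothOn_frameDeriv d hU Set.inter_subset_left
      (e.isSmoothOn_transition h a b)).isDiffAt hU hx

/-- With `A` the connection of `h` taken along `e`, the law `X Γ = A X + dX` is a gauge
transformation, under which curvature is conjugated: the second derivatives of `X` cancel by the
commutator formula. Since `bracket_transition` accounts for the derivatives of the vectors, the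
curvature of `A` is tensorial in its form indices. -/
theorem riemannUp_transition (hx : x ∈ e.domain ∩ h.domain) (a b c d : Fin 3) :
    ∑ k, e.transition h a k x * e.riemannUp k b c d x
      = ∑ p, (∑ r, ∑ s, e.transition h r c x * e.transition h s d x * h.riemannUp a p r s x)
          * e.transition h p b x := by
  have hcomm := e.frameDeriv_comm (e.isOpen_inter_domain h) Set.inter_subset_left hx
    (e.isSmoothOn_transition h a b) c d
  have hbr := e.bracket_transition h hx c d
  have hC := fun b c => e.conn_transition' h hx a b c
  have hD1 := e.frameDeriv_conn_transition h hx a b c d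
  have hD2 := e.frameDeriv_conn_transition h hx a b d c
  -- the curvature of the connection matrices along `e`
  have hF : ∀ p, e.frameDeriv c (e.connAlong h a p d) x - e.frameDeriv d (e.connAlong h a p c) x
      + ∑ f, (e.connAlong h a f c x * e.connAlong h f p d x
          - e.connAlong h a f d x * e.connAlong h f p c x)
      - ∑ f, e.bracketCoeff f c d x * e.connAlong h a p f x
      = ∑ r, ∑ s, e.transition h r c x * e.transition h s d x * h.riemannUp a p r s x := by
    intro p
    have h1 : ∑ f, e.bracketCoeff f c d x * e.connAlong h a p f x
        = ∑ k, (∑ f, e.bracketCoeff f c d x * e.transition h k f x) * h.conn a p k x := by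
      simp only [connAlong, Fin.sum_univ_three]
      ring
    rw [h1]
    simp only [hbr, e.frameDeriv_connAlong h hx, riemannUp, connAlong]
    simp only [Fin.sum_univ_three]
    ring
  simp only [← hF]
  have h2 : ∑ k, e.transition h a k x * e.riemannUp k b c d x
      = (∑ k, e.transition h a k x * e.frameDeriv c (e.conn k b d) x)
        - (∑ k, e.transition h a k x * e.frameDeriv d (e.conn k b c) x)
        + ∑ f, ((∑ k, e.transition h a k x * e.conn k f c x) * e.conn f b d x
            - (∑ k, e.transition h a k x * e.conn k f d x) * e.conn f b c x)
        - ∑ f, e.bracketCoeff f c d x * ∑ k, e.transition h a k x * e.conn k b f x := by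
    simp only [riemannUp, Fin.sum_univ_three]
    ring
  rw [h2]
  simp only [hC]
  have h3 := fun f => e.conn_transition' h hx f b d
  have h4 := fun f => e.conn_transition' h hx f b c
  simp only [Fin.sum_univ_three] at hcomm hD1 hD2 h3 h4 ⊢
  linear_combination hcomm + hD1 - hD2
    + e.connAlong h a 0 c x * h3 0 + e.connAlong h a 1 c x * h3 1 + e.connAlong h a 2 c x * h3 2
    - e.connAlong h a 0 d x * h4 0 - e.connAlong h a 1 d x * h4 1 - e.connAlong h a 2 d x * h4 2

theorem riemann_transition (hx : x ∈ e.domain ∩ h.domain) (a b c d : Fin 3) :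
    e.riemann a b c d x = ∑ p, ∑ q, ∑ r, ∑ s, e.transition h p a x * e.transition h q b x
      * e.transition h r c x * e.transition h s d x * h.riemann p q r s x := by
  have h2 := e.sum_transition_eta h hx a
  have h3 : e.riemann a b c d x = ∑ f, (∑ p, ∑ q, eta p q * e.transition h p a x *
      e.transition h q f x) * e.riemannUp f b c d x := by
    simp only [h2, riemann]
  have h4 : e.riemann a b c d x = ∑ p, ∑ q, eta p q * e.transition h p a x *
      ∑ f, e.transition h q f x * e.riemannUp f b c d x := by
    rw [h3]
    simp only [Fin.sum_univ_three]
    ring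
  rw [h4]
  simp only [e.riemannUp_transition h hx, riemann, Finset.mul_sum, Finset.sum_mul]
  refine Finset.sum_congr rfl fun p _ => ?_
  rw [Finset.sum_comm]
  refine Finset.sum_congr rfl fun q _ => ?_
  rw [Finset.sum_comm]
  refine Finset.sum_congr rfl fun r _ => ?_
  rw [Finset.sum_comm]
  refine Finset.sum_congr rfl fun s _ => ?_
  refine Finset.sum_congr rfl fun t _ => ?_
  ring

/-- The inverse of the transition matrix. -/
theorem exists_transition_inv (hx : x ∈ e.domain ∩ h.domain) :
    ∃ Y : Fin 3 → Fin 3 → ℝ, (∀ a b, ∑ k, Y a k * e.transition h k b x = if a = b then 1 else 0) ∧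
      ∀ a b, ∑ k, e.transition h a k x * Y k b = if a = b then 1 else 0 := by
  have hee : etaInv * eta = 1 := by
    ext i j; rw [Matrix.mul_apply, etaInv_mul_eta, Matrix.one_apply]
  have h1 : (etaInv * (e.transitionMatrix h x)ᵀ * eta) * e.transitionMatrix h x = 1 := by
    rw [Matrix.mul_assoc, Matrix.mul_assoc, ← Matrix.mul_assoc _ eta,
      e.transitionMatrix_eta h hx, hee]
  have h2 := mul_eq_one_comm.mp h1
  refine ⟨etaInv * (e.transitionMatrix h x)ᵀ * eta, fun a b => ?_, fun a b => ?_⟩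
  · rw [← Matrix.one_apply, ← h1, Matrix.mul_apply]; rfl
  · rw [← Matrix.one_apply, ← h2, Matrix.mul_apply]; rfl

theorem ricci_transition (hx : x ∈ e.domain ∩ h.domain) (b d : Fin 3) :
    e.ricci b d x = ∑ p, ∑ s, e.transition h p b x * e.transition h s d x * h.ricci p s x := by
  obtain ⟨Y, hY, hY'⟩ := e.exists_transition_inv h hx
  have h1 : ∀ c, e.riemannUp c b c d x = ∑ k, Y c k *
      ∑ f, e.transition h k f x * e.riemannUp f b c d x := by
    intro c
    calc e.riemannUp c b c d x = ∑ f, (if c = f then 1 else 0) * e.riemannUp f b c d x := by simp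
      _ = _ := by
        simp only [← hY]
        simp only [Fin.sum_univ_three]
        ring
  have h2 : e.ricci b d x = ∑ k, ∑ r, (∑ c, e.transition h r c x * Y c k) *
      ∑ p, ∑ s, e.transition h p b x * e.transition h s d x * h.riemannUp k p r s x := by
    simp only [ricci, h1, e.riemannUp_transition h hx]
    simp only [Fin.sum_univ_three]
    ring
  rw [h2]
  simp only [hY', ricci, Fin.sum_univ_three]
  simp
  ring

theorem scalar_transition (hx : x ∈ e.domain ∩ h.domain) : e.scalar x = h.scalar x := by
  have h0 := e.sum_transition_etaInv h hx
  have h1 : h.scalar x = ∑ k, ∑ l, (∑ p, ∑ q, etaInv p q * e.transition h k p x *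
      e.transition h l q x) * h.ricci k l x := by
    simp only [h0, scalar]
  rw [h1]
  simp only [scalar, e.ricci_transition h hx]
  simp only [Fin.sum_univ_three]
  ring

theorem tracefreeRicci_transition (hx : x ∈ e.domain ∩ h.domain) (b d : Fin 3) :
    e.tracefreeRicci b d x
      = ∑ p, ∑ s, e.transition h p b x * e.transition h s d x * h.tracefreeRicci p s x := by
  simp only [tracefreeRicci, e.ricci_transition h hx, e.scalar_transition h hx,
    ← e.sum_transition_eta h hx b d, Fin.sum_univ_three]
  ring

/-- Covariant differentiation commutes with changes of frame. -/
theorem covDeriv_transition {k : ℕ} {T' T : M → Tensor k}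
    (hT : ∀ a, IsSmoothOn (fun y => T y a) h.domain)
    (hTT : ∀ y ∈ e.domain ∩ h.domain, T' y = pull (fun b a => e.transition h b a y) (T y))
    (hx : x ∈ e.domain ∩ h.domain) :
    e.covDeriv T' x = pull (fun b a => e.transition h b a x) (h.covDeriv T x) := by
  funext a
  have hU := e.isOpen_inter_domain h
  have hX := e.isDiffAt_transition h hx
  have hTd : ∀ b, IsDiffAt (fun y => T y b) x := fun b =>
    (hT b).isDiffAt h.isOpen_domain hx.2
  have hPs : ∀ b : Fin k → Fin 3, IsSmoothOn
      (fun y => ∏ i, e.transition h (b i) (Fin.init a i) y) (e.domain ∩ h.domain) := fun b =>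
    IsSmoothOn.prod _ fun i _ => e.isSmoothOn_transition h _ _
  set X : Fin 3 → Fin 3 → ℝ := fun b a => e.transition h b a x with hXdef
  set c := a (Fin.last k) with hc
  set a0 : Fin k → Fin 3 := Fin.init a with ha0
  -- the derivative of the transformed components
  have h1 : e.frameDeriv c (fun y => T' y a0) x
      = ∑ b : Fin k → Fin 3, ((∑ i, (∏ j ∈ Finset.univ.erase i, X (b j) (a0 j))
          * e.frameDeriv c (e.transition h (b i) (a0 i)) x) * T x b
        + (∏ i, X (b i) (a0 i)) * ∑ d, X d c * h.frameDeriv d (fun y => T y b) x) := by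
    rw [e.frameDeriv_congr c hU hx (f' := fun y => ∑ b : Fin k → Fin 3,
      (∏ i, e.transition h (b i) (a0 i) y) * T y b) fun y hy => by rw [hTT y hy]; rfl]
    rw [e.frameDeriv_sum c _ (f := fun (b : Fin k → Fin 3) y =>
      (∏ i, e.transition h (b i) (a0 i) y) * T y b)
      fun b _ => ((hPs b).isDiffAt hU hx).mul (hTd b)]
    refine Finset.sum_congr rfl fun b _ => ?_
    rw [frameDeriv_mul _ _ ((hPs b).isDiffAt hU hx) (hTd b),
      frameDeriv_prod _ _ _ fun i _ => hX _ _,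
      e.frameDeriv_eq_sum_transition h hx.2 c fun y => T y b]
  -- The inhomogeneous part of the connection law produces, slot by slot, exactly the derivatives of
  -- `X` that the product rule creates in `h1`.
  have h2 : ∀ i, ∑ m, e.conn m (a0 i) c x * T' x (Function.update a0 i m)
      = ∑ b : Fin k → Fin 3, (∏ j ∈ Finset.univ.erase i, X (b j) (a0 j))
          * (e.frameDeriv c (e.transition h (b i) (a0 i)) x
            + ∑ f, (∑ p, h.conn (b i) p f x * X p (a0 i)) * X f c) * T x b := by
    intro i
    have h3 : ∀ b : Fin k → Fin 3, ∀ m, ∏ j, X (b j) (Function.update a0 i m j)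
        = X (b i) m * ∏ j ∈ Finset.univ.erase i, X (b j) (a0 j) := by
      intro b m
      rw [← Finset.mul_prod_erase _ _ (Finset.mem_univ i), Function.update_self]
      congr 1
      refine Finset.prod_congr rfl fun j hj => ?_
      rw [Function.update_of_ne (Finset.ne_of_mem_erase hj)]
    rw [hTT x hx]
    simp only [pull, Finset.mul_sum]
    rw [Finset.sum_comm]
    refine Finset.sum_congr rfl fun b _ => ?_
    have h4 := e.conn_transition h hx (b i) (a0 i) c
    rw [nabla] at h4
    change _ = (∏ j ∈ Finset.univ.erase i, X (b j) (a0 j)) * (e.frameDeriv c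
      (e.transition h (b i) (a0 i)) x + ∑ f, (∑ p, h.conn (b i) p f x
        * e.transition h p (a0 i) x) * e.transition h f c x) * T x b
    rw [← h4]
    have h5 : ∀ m, ∏ j, e.transition h (b j) (Function.update a0 i m j) x
        = X (b i) m * ∏ j ∈ Finset.univ.erase i, X (b j) (a0 j) := h3 b
    simp only [h5, Finset.mul_sum, Finset.sum_mul]
    refine Finset.sum_congr rfl fun m _ => ?_
    simp only [hXdef]
    ring
  -- The homogeneous connection terms agree after the contracted index trades places with the `i`th
  -- summation index.
  have h6 : ∀ i, ∑ b : Fin k → Fin 3, (∏ j, X (b j) (a0 j)) * ∑ d, X d c * ∑ m,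
        h.conn m (b i) d x * T x (Function.update b i m)
      = ∑ b : Fin k → Fin 3, (∏ j ∈ Finset.univ.erase i, X (b j) (a0 j))
          * (∑ f, (∑ p, h.conn (b i) p f x * X p (a0 i)) * X f c) * T x b := by
    intro i
    have h7 := sum_update_swap i fun (b : Fin k → Fin 3) m =>
      (∏ j ∈ Finset.univ.erase i, X (b j) (a0 j)) * X (b i) (a0 i) *
        (∑ d, X d c * h.conn m (b i) d x) * T x (Function.update b i m)
    refine Eq.trans ?_ (h7.trans ?_)
    · refine Finset.sum_congr rfl fun b _ => ?_
      rw [← Finset.prod_erase_mul _ _ (Finset.mem_univ i)]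
      simp only [Fin.sum_univ_three]
      ring
    · refine Finset.sum_congr rfl fun b _ => ?_
      have h8 : ∀ m, ∏ j ∈ Finset.univ.erase i, X (Function.update b i m j) (a0 j)
          = ∏ j ∈ Finset.univ.erase i, X (b j) (a0 j) := fun m =>
        Finset.prod_congr rfl fun j hj => by
          rw [Function.update_of_ne (Finset.ne_of_mem_erase hj)]
      simp only [h8, Function.update_self, Function.update_idem, Function.update_eq_self]
      simp only [Fin.sum_univ_three]
      ring
  rw [pull_snoc]
  simp only [covDeriv, ← hc, ← ha0, Fin.init_snoc, Fin.snoc_last]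
  rw [h1]
  simp only [h2]
  have h9 : ∑ b : Fin k → Fin 3, (∏ i, X (b i) (a0 i)) * ∑ d, X d c *
        (h.frameDeriv d (fun y => T y b) x
          - ∑ i, ∑ m, h.conn m (b i) d x * T x (Function.update b i m))
      = (∑ b : Fin k → Fin 3, (∏ i, X (b i) (a0 i)) * ∑ d, X d c *
          h.frameDeriv d (fun y => T y b) x)
        - ∑ i, ∑ b : Fin k → Fin 3, (∏ j, X (b j) (a0 j)) * ∑ d, X d c * ∑ m,
          h.conn m (b i) d x * T x (Function.update b i m) := by
    rw [Finset.sum_comm (γ := Fin k), ← Finset.sum_sub_distrib]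
    refine Finset.sum_congr rfl fun b _ => ?_
    rw [← Finset.mul_sum, ← mul_sub]
    congr 1
    rw [Finset.sum_comm, ← Finset.sum_sub_distrib]
    refine Finset.sum_congr rfl fun d _ => ?_
    rw [← Finset.mul_sum, mul_sub]
  rw [h9]
  simp only [h6]
  simp only [mul_add, add_mul, Finset.sum_add_distrib]
  rw [show ∑ b : Fin k → Fin 3, (∑ i, (∏ j ∈ Finset.univ.erase i, X (b j) (a0 j))
        * e.frameDeriv c (e.transition h (b i) (a0 i)) x) * T x b
      = ∑ i, ∑ b : Fin k → Fin 3, (∏ j ∈ Finset.univ.erase i, X (b j) (a0 j))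
        * e.frameDeriv c (e.transition h (b i) (a0 i)) x * T x b by
    rw [Finset.sum_comm]; simp only [Finset.sum_mul]]
  ring

theorem curvatureDeriv_transition (k : ℕ) (hx : x ∈ e.domain ∩ h.domain) :
    e.curvatureDeriv k x
      = pull (fun b a => e.transition h b a x) (h.curvatureDeriv k x) := by
  induction k generalizing x with
  | zero =>
    funext a
    have h1 := pull_four (fun b a => e.transition h b a x) (fun p q r s => h.riemann p q r s x) a
    rw [← e.riemann_transition h hx] at h1
    exact h1.symm
  | succ k ih =>
    exact e.covDeriv_transition h (h.isSmoothOn_curvatureDeriv k) (fun y hy => ih hy) hx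

end MovingFrame

namespace MovingFrame

variable (e : MovingFrame g) {x : M}

/-! ### Symmetries of the curvature -/

theorem isDiffAt_connLow (hx : x ∈ e.domain) (a b c : Fin 3) : IsDiffAt (e.connLow a b c) x :=
  (e.isSmoothOn_connLow a b c).isDiffAt e.isOpen_domain hx

theorem frameDeriv_connLow_eq_sum (hx : x ∈ e.domain) (a b c d : Fin 3) :
    e.frameDeriv d (e.connLow a b c) x = ∑ f, eta a f * e.frameDeriv d (e.conn f b c) x := by
  have h1 : e.connLow a b c = fun y => ∑ f, eta a f * e.conn f b c y := by
    funext y; exact e.connLow_eq_sum a b c y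
  rw [h1, e.frameDeriv_sum d _ (f := fun f y => eta a f * e.conn f b c y) fun f _ =>
    MDifferentiableAt.mul mdifferentiableAt_const (e.isDiffAt_conn hx f b c)]
  exact Finset.sum_congr rfl fun f _ => e.frameDeriv_const_mul d _ (e.isDiffAt_conn hx f b c)

theorem frameDeriv_connLow_antisymm (a b c d : Fin 3) :
    e.frameDeriv d (e.connLow a b c) x = -e.frameDeriv d (e.connLow b a c) x := by
  have h1 : e.connLow a b c = -e.connLow b a c := by
    funext y; exact e.connLow_antisymm a b c y
  simp only [frameDeriv_eq, h1, mvfderiv_neg]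
  rfl

/-- The curvature components with all indices down. -/
theorem riemann_eq (hx : x ∈ e.domain) (a b c d : Fin 3) :
    e.riemann a b c d x = e.frameDeriv c (e.connLow a b d) x - e.frameDeriv d (e.connLow a b c) x
      + ∑ f, (e.connLow a f c x * e.conn f b d x - e.connLow a f d x * e.conn f b c x)
      - ∑ f, (e.conn f d c x - e.conn f c d x) * e.connLow a b f x := by
  simp only [riemann, riemannUp, e.frameDeriv_connLow_eq_sum hx, e.connLow_eq_sum,
    e.bracketCoeff_eq_conn, Fin.sum_univ_three]
  ring

theorem riemann_antisymm_right (a b c d : Fin 3) (x : M) :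
    e.riemann a b c d x = -e.riemann a b d c x := by
  simp only [riemann, riemannUp, e.bracketCoeff_eq_conn, Fin.sum_univ_three]
  ring

theorem riemann_antisymm_left (hx : x ∈ e.domain) (a b c d : Fin 3) :
    e.riemann a b c d x = -e.riemann b a c d x := by
  rw [e.riemann_eq hx, e.riemann_eq hx, e.frameDeriv_connLow_antisymm b a,
    e.frameDeriv_connLow_antisymm b a]
  simp only [e.connLow_antisymm b a]
  have h0 : ∀ a f, e.conn 0 a f x = -e.connLow 2 a f x := by
    simp [conn, Fin.sum_univ_three, etaInv]
  have h1 : ∀ a f, e.conn 1 a f x = 2 * e.connLow 1 a f x := by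
    simp [conn, Fin.sum_univ_three, etaInv]
  have h2 : ∀ a f, e.conn 2 a f x = -e.connLow 0 a f x := by
    simp [conn, Fin.sum_univ_three, etaInv]
  simp only [Fin.sum_univ_three, h0, h1, h2]
  rw [e.connLow_antisymm a 0 c, e.connLow_antisymm a 1 c, e.connLow_antisymm a 2 c,
    e.connLow_antisymm a 0 d, e.connLow_antisymm a 1 d, e.connLow_antisymm a 2 d,
    e.connLow_antisymm b 0 c, e.connLow_antisymm b 1 c, e.connLow_antisymm b 2 c,
    e.connLow_antisymm b 0 d, e.connLow_antisymm b 1 d, e.connLow_antisymm b 2 d]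
  ring

theorem riemannUp_eq (a b c d : Fin 3) (x : M) :
    e.riemannUp a b c d x = ∑ f, etaInv a f * e.riemann f b c d x := by
  simp only [riemann, Fin.sum_univ_three]
  fin_cases a <;> simp [eta, etaInv]

/-- The first Bianchi identity. -/
theorem first_bianchi (hx : x ∈ e.domain) (h a b c : Fin 3) :
    e.riemannUp h a b c x + e.riemannUp h b c a x + e.riemannUp h c a b x = 0 := by
  -- Torsion vanishes, so the commutator coefficients are antisymmetrized connection components and
  -- the Jacobi identity becomes the Bianchi identity.
  have hJ := e.jacobi hx a b c h
  have hD : ∀ a b c, e.frameDeriv a (e.bracketCoeff h b c) x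
      = e.frameDeriv a (e.conn h c b) x - e.frameDeriv a (e.conn h b c) x := by
    intro a b c
    rw [← e.frameDeriv_sub a (e.isDiffAt_conn hx _ _ _) (e.isDiffAt_conn hx _ _ _)]
    congr 1
    funext y
    exact e.bracketCoeff_eq_conn h b c y
  simp only [hD, e.bracketCoeff_eq_conn, Fin.sum_univ_three] at hJ
  simp only [riemannUp, e.bracketCoeff_eq_conn, Fin.sum_univ_three]
  linear_combination hJ

/-- Trace of the first Bianchi identity: one of its three terms is the trace over the first index
pair, which vanishes by antisymmetry. -/
theorem ricci_symm (hx : x ∈ e.domain) (a b : Fin 3) : e.ricci a b x = e.ricci b a x := by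
  have h1 : ∀ c d, ∑ f, e.riemannUp f f c d x = 0 := by
    intro c d
    have h := e.riemann_antisymm_left hx
    simp only [riemannUp_eq, Fin.sum_univ_three, etaInv]
    simp
    linarith [h 1 1 c d, h 2 0 c d]
  have h2 : ∀ c a d, e.riemannUp c a c d x = -e.riemannUp c a d c x := by
    intro c a d
    simp only [riemannUp_eq, e.riemann_antisymm_right _ a c d, Fin.sum_univ_three]
    ring
  have h3 := fun c => e.first_bianchi hx c a c b
  have h4 : ∑ c, (e.riemannUp c a c b x + e.riemannUp c c b a x + e.riemannUp c b a c x) = 0 :=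
    Finset.sum_eq_zero fun c _ => h3 c
  rw [Finset.sum_add_distrib, Finset.sum_add_distrib, h1] at h4
  simp only [ricci]
  simp only [h2 _ b a, Finset.sum_neg_distrib]
  linarith

theorem tracefreeRicci_symm (hx : x ∈ e.domain) (a b : Fin 3) :
    e.tracefreeRicci a b x = e.tracefreeRicci b a x := by
  rw [tracefreeRicci, e.ricci_symm hx, eta_symm, tracefreeRicci]

/-- The trace with `η^{ab}` is `-2 S₀₂ + 2 S₁₁`. -/
theorem tracefreeRicci_one_one (hx : x ∈ e.domain) :
    e.tracefreeRicci 1 1 x = e.tracefreeRicci 0 2 x := by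
  have h := e.ricci_symm hx 2 0
  simp only [tracefreeRicci, scalar, Fin.sum_univ_three, etaInv, eta]
  simp
  linarith

end MovingFrame

/-! ### Curvature tensors with rotational symmetry about a timelike axis -/

/-- The covector of `-(ℓ + n)`. -/
def axis : Fin 3 → ℝ := ![1, 0, 1]

/-- The algebraic curvature tensor with trace-free Ricci part along the axis. -/
def axialCurvature (κ β : ℝ) (a b c d : Fin 3) : ℝ :=
  κ * (eta a c * eta b d - eta a d * eta b c)
    + β * (eta a c * (axis b * axis d) - eta a d * (axis b * axis c)
      + eta b d * (axis a * axis c) - eta b c * (axis a * axis d))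

theorem eq_zero_of_antisymm {D : Fin 3 → Fin 3 → ℝ} (hD : ∀ a b, D a b = -D b a)
    (h01 : D 0 1 = 0) (h02 : D 0 2 = 0) (h12 : D 1 2 = 0) (a b : Fin 3) : D a b = 0 := by
  fin_cases a <;> fin_cases b <;> simp <;>
    linarith [hD 0 0, hD 1 1, hD 2 2, hD 1 0, hD 2 0, hD 2 1]

namespace MovingFrame

variable (e : MovingFrame g) {x : M}

/-- Under these normalizations the trace-free Ricci tensor is `3Ψ₂ u ⊗ u + 2Ψ₂ η` with `u` the
covector `axis`. Antisymmetry in both index pairs leaves nine curvature components, and the nine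
Ricci equations determine them. -/
theorem riemann_eq_axialCurvature (hx : x ∈ e.domain) (h0 : e.psi 1 x = 0) (h1 : e.psi 3 x = 0)
    (h2 : e.psi 0 x = 3 * e.psi 2 x) (h3 : e.psi 4 x = 3 * e.psi 2 x) :
    ∃ κ, ∀ a b c d, e.riemann a b c d x = axialCurvature κ (3 * e.psi 2 x) a b c d := by
  have hs := e.tracefreeRicci_symm hx
  have h11 := e.tracefreeRicci_one_one hx
  have hl := e.riemann_antisymm_left hx
  have hr := fun a b c d => e.riemann_antisymm_right a b c d x
  simp [psi] at h0 h1 h2 h3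
  -- The contraction of `axialCurvature κ β` is `β u ⊗ u + (2κ - 2β) η`. Comparing with the Ricci
  -- tensor at `β = 3Ψ₂` gives this value of `κ`.
  refine ⟨e.scalar x / 6 + 4 * e.psi 2 x, ?_⟩
  set s := e.scalar x
  set q := e.tracefreeRicci 0 2 x
  have hq : e.psi 2 x = q := by simp [psi, q]
  have hq' : e.tracefreeRicci 0 2 x = q := rfl
  rw [hq]
  have hric : ∀ a b, e.ricci a b x = e.tracefreeRicci a b x + s / 3 * eta a b := by
    intro a b; simp only [tracefreeRicci, s]; ring
  have hric' : ∀ b d, e.ricci b d x = -e.riemann 2 b 0 d x + 2 * e.riemann 1 b 1 d x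
      - e.riemann 0 b 2 d x := by
    intro b d
    simp only [ricci, riemannUp_eq, Fin.sum_univ_three, etaInv]
    simp
    ring
  have r00 := (hric' 0 0).symm.trans (hric 0 0)
  have r01 := (hric' 0 1).symm.trans (hric 0 1)
  have r02 := (hric' 0 2).symm.trans (hric 0 2)
  have r10 := (hric' 1 0).symm.trans (hric 1 0)
  have r11 := (hric' 1 1).symm.trans (hric 1 1)
  have r12 := (hric' 1 2).symm.trans (hric 1 2)
  have r20 := (hric' 2 0).symm.trans (hric 2 0)
  have r21 := (hric' 2 1).symm.trans (hric 2 1)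
  have r22 := (hric' 2 2).symm.trans (hric 2 2)
  rw [hs 1 0] at r10
  rw [hs 2 0] at r20
  rw [hs 2 1] at r21
  rw [h11] at r11
  simp only [h0, h1, h2, h3, hq'] at r00 r01 r02 r10 r11 r12 r20 r21 r22
  have hz : ∀ a c d, e.riemann a a c d x = 0 := fun a c d => by linarith [hl a a c d]
  have hz' : ∀ a b c, e.riemann a b c c x = 0 := fun a b c => by linarith [hr a b c c]
  simp only [hz, hz', hl 1 0, hl 2 0, hl 2 1, hr _ _ 1 0, hr _ _ 2 0, hr _ _ 2 1, eta]
    at r00 r01 r02 r10 r11 r12 r20 r21 r22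
  simp at r00 r01 r02 r10 r11 r12 r20 r21 r22
  have key : ∀ a b c d,
      e.riemann a b c d x - axialCurvature (s / 6 + 4 * q) (3 * q) a b c d = 0 := by
    intro a b
    refine eq_zero_of_antisymm (fun c d => ?_) ?_ ?_ ?_
    · rw [hr a b c d]; simp only [axialCurvature]; ring
    all_goals
      revert a b
      refine eq_zero_of_antisymm (fun a b => ?_) ?_ ?_ ?_
      · rw [hl a b]; simp only [axialCurvature]; ring
      all_goals
        simp [axialCurvature, eta, axis]
        linarith
  intro a b c d
  linarith [key a b c d]

end MovingFrame

/-! ### The infinitesimal action on tensors -/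

/-- The action of an endomorphism on covariant tensors, as a derivation. -/
def deriveTensor (A : Matrix (Fin 3) (Fin 3) ℝ) {k : ℕ} (T : Tensor k) : Tensor k := fun a =>
  ∑ i, ∑ b, A b (a i) * T (Function.update a i b)

theorem deriveTensor_add (A B : Matrix (Fin 3) (Fin 3) ℝ) {k : ℕ} (T : Tensor k) :
    deriveTensor (A + B) T = deriveTensor A T + deriveTensor B T := by
  funext a
  simp only [deriveTensor, Matrix.add_apply, add_mul, Finset.sum_add_distrib, Pi.add_apply]

theorem deriveTensor_smul (r : ℝ) (A : Matrix (Fin 3) (Fin 3) ℝ) {k : ℕ} (T : Tensor k) :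
    deriveTensor (r • A) T = r • deriveTensor A T := by
  funext a
  simp only [deriveTensor, Matrix.smul_apply, smul_eq_mul, Pi.smul_apply, Finset.mul_sum, mul_assoc]

theorem deriveTensor_zero (A : Matrix (Fin 3) (Fin 3) ℝ) (k : ℕ) :
    deriveTensor A (0 : Tensor k) = 0 := by
  funext a; simp [deriveTensor]

/-- Two derivations hitting the same slot compose to `B * A`; hitting different slots they give the
double sum, which is symmetric in `A` and `B` and so disappears from commutators. -/
theorem deriveTensor_deriveTensor (A B : Matrix (Fin 3) (Fin 3) ℝ) {k : ℕ} (T : Tensor k)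
    (a : Fin k → Fin 3) :
    deriveTensor A (deriveTensor B T) a = deriveTensor (B * A) T a
      + ∑ i, ∑ j ∈ Finset.univ.erase i, ∑ b, ∑ c, A b (a i) * B c (a j)
          * T (Function.update (Function.update a i b) j c) := by
  simp only [deriveTensor]
  rw [← Finset.sum_add_distrib]
  refine Finset.sum_congr rfl fun i _ => ?_
  have h1 : ∀ b, ∑ j, ∑ c, B c (Function.update a i b j)
        * T (Function.update (Function.update a i b) j c)
      = ∑ c, B c b * T (Function.update a i c) + ∑ j ∈ Finset.univ.erase i, ∑ c, B c (a j)
        * T (Function.update (Function.update a i b) j c) := by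
    intro b
    rw [← Finset.add_sum_erase _ _ (Finset.mem_univ i)]
    congr 1
    · simp
    · refine Finset.sum_congr rfl fun j hj => ?_
      rw [Function.update_of_ne (Finset.ne_of_mem_erase hj)]
  simp only [h1, mul_add, Finset.sum_add_distrib]
  congr 1
  · simp only [Matrix.mul_apply, Fin.sum_univ_three]
    ring
  · simp only [Finset.mul_sum, mul_assoc]
    rw [Finset.sum_comm]

theorem deriveTensor_comm (A B : Matrix (Fin 3) (Fin 3) ℝ) {k : ℕ} (T : Tensor k) :
    deriveTensor A (deriveTensor B T) + deriveTensor (A * B) T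
      = deriveTensor B (deriveTensor A T) + deriveTensor (B * A) T := by
  funext a
  simp only [Pi.add_apply, deriveTensor_deriveTensor]
  have h1 : ∀ A B : Matrix (Fin 3) (Fin 3) ℝ, (∑ i, ∑ j ∈ Finset.univ.erase i, ∑ b, ∑ c,
        A b (a i) * B c (a j) * T (Function.update (Function.update a i b) j c))
      = ∑ i, ∑ j, if i ≠ j then ∑ b, ∑ c, A b (a i) * B c (a j)
          * T (Function.update (Function.update a i b) j c) else 0 := by
    intro A B
    refine Finset.sum_congr rfl fun i _ => ?_
    rw [← Finset.sum_filter]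
    refine Finset.sum_congr ?_ fun _ _ => rfl
    ext j; simp [eq_comm]
  have h2 : (∑ i, ∑ j, if i ≠ j then ∑ b, ∑ c, A b (a i) * B c (a j)
          * T (Function.update (Function.update a i b) j c) else 0)
      = ∑ i, ∑ j, if i ≠ j then ∑ b, ∑ c, B b (a i) * A c (a j)
          * T (Function.update (Function.update a i b) j c) else 0 := by
    rw [Finset.sum_comm]
    refine Finset.sum_congr rfl fun i _ => Finset.sum_congr rfl fun j _ => ?_
    by_cases hij : i = j
    · simp [hij]
    · rw [if_pos (Ne.symm hij), if_pos hij, Finset.sum_comm]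
      refine Finset.sum_congr rfl fun b _ => Finset.sum_congr rfl fun c _ => ?_
      rw [Function.update_comm hij]
      ring
  rw [h1 A B, h1 B A, h2]
  ring

theorem deriveTensor_snoc (A : Matrix (Fin 3) (Fin 3) ℝ) {k : ℕ} (T : Tensor (k + 1))
    (a : Fin k → Fin 3) (c : Fin 3) :
    deriveTensor A T (Fin.snoc a c)
      = deriveTensor A (fun a' => T (Fin.snoc a' c)) a + ∑ b, A b c * T (Fin.snoc a b) := by
  simp only [deriveTensor]
  rw [Fin.sum_univ_castSucc]
  congr 1
  · refine Finset.sum_congr rfl fun i _ => Finset.sum_congr rfl fun b _ => ?_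
    rw [Fin.snoc_castSucc, Fin.snoc_update]
  · refine Finset.sum_congr rfl fun b _ => ?_
    rw [Fin.snoc_last, Fin.update_snoc_last]

/-- Covariant derivatives of an invariant tensor along an equivariant family are invariant. -/
theorem deriveTensor_eq_zero_of_equivariant {J : Matrix (Fin 3) (Fin 3) ℝ}
    {B : Fin 3 → Matrix (Fin 3) (Fin 3) ℝ} {k : ℕ} {T : Tensor k} {T' : Tensor (k + 1)}
    (hT' : ∀ a c, T' (Fin.snoc a c) = -deriveTensor (B c) T a) (hJ : deriveTensor J T = 0)
    (hB : ∀ c, B c * J + ∑ b, J b c • B b = J * B c) : deriveTensor J T' = 0 := by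
  funext a
  obtain ⟨a, c, rfl⟩ : ∃ a' c, a = Fin.snoc a' c :=
    ⟨Fin.init a, a (Fin.last k), (Fin.snoc_init_self a).symm⟩
  rw [deriveTensor_snoc]
  simp only [hT']
  -- As `J` annihilates `T`, moving it past `B c` leaves only a commutator; equivariance of the
  -- family `B` makes this cancel the term where `J` acts on the new index.
  have h1 := congrFun (deriveTensor_comm J (B c) T) a
  rw [hJ, deriveTensor_zero, ← hB c] at h1
  simp only [Fin.sum_univ_three, deriveTensor_add, deriveTensor_smul, Pi.add_apply, Pi.smul_apply,
    Pi.zero_apply, smul_eq_mul] at h1 ⊢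
  have h2 : deriveTensor J (fun a' => -deriveTensor (B c) T a') a
      = -deriveTensor J (deriveTensor (B c) T) a := by
    simp [deriveTensor]
  rw [h2]
  linarith

/-- The infinitesimal rotation about `ℓ + n`. -/
def axialRotation : Matrix (Fin 3) (Fin 3) ℝ := !![0, 1, 0; -2, 0, 2; 0, -1, 0]

theorem deriveTensor_four (A : Matrix (Fin 3) (Fin 3) ℝ) (T : Fin 3 → Fin 3 → Fin 3 → Fin 3 → ℝ)
    (a : Fin 4 → Fin 3) :
    deriveTensor A (k := 4) (fun b => T (b 0) (b 1) (b 2) (b 3)) a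
      = ∑ m, A m (a 0) * T m (a 1) (a 2) (a 3) + ∑ m, A m (a 1) * T (a 0) m (a 2) (a 3)
        + ∑ m, A m (a 2) * T (a 0) (a 1) m (a 3) + ∑ m, A m (a 3) * T (a 0) (a 1) (a 2) m := by
  simp [deriveTensor, Fin.sum_univ_four, Function.update]

/-- The derivative of an axial curvature tensor along a skew endomorphism. -/
theorem derive_axialCurvature {A : Matrix (Fin 3) (Fin 3) ℝ}
    (hA : ∀ a b, ∑ m, A m a * eta m b + ∑ m, A m b * eta a m = 0) (κ β : ℝ) (a b c d : Fin 3) :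
    ∑ m, A m a * axialCurvature κ β m b c d + ∑ m, A m b * axialCurvature κ β a m c d
        + ∑ m, A m c * axialCurvature κ β a b m d + ∑ m, A m d * axialCurvature κ β a b c m
      = β * (eta a c * ((∑ m, A m b * axis m) * axis d + axis b * ∑ m, A m d * axis m)
        - eta a d * ((∑ m, A m b * axis m) * axis c + axis b * ∑ m, A m c * axis m)
        + eta b d * ((∑ m, A m a * axis m) * axis c + axis a * ∑ m, A m c * axis m)
        - eta b c * ((∑ m, A m a * axis m) * axis d + axis a * ∑ m, A m d * axis m)) := by
  have hac := hA a c
  have had := hA a d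
  have hbc := hA b c
  have hbd := hA b d
  simp only [Fin.sum_univ_three, axialCurvature] at *
  linear_combination (κ * eta b d + β * axis b * axis d) * hac
    - (κ * eta b c + β * axis b * axis c) * had
    + (κ * eta a c + β * axis a * axis c) * hbd - (κ * eta a d + β * axis a * axis d) * hbc

theorem derive_axialRotation_axialCurvature (κ β : ℝ) :
    deriveTensor axialRotation (k := 4) (fun a => axialCurvature κ β (a 0) (a 1) (a 2) (a 3)) = 0 := by
  funext a
  rw [deriveTensor_four, derive_axialCurvature]
  · have h : ∀ b, ∑ m, axialRotation m b * axis m = 0 := by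
      intro b; fin_cases b <;> simp [axialRotation, axis, Fin.sum_univ_three]
    simp only [h]
    simp
  · intro a b
    fin_cases a <;> fin_cases b <;> simp [axialRotation, eta, Fin.sum_univ_three]

/-! ### The structure equations for constant boost components -/

/-- The equations express that `d` has zero cross product with `(P, -(Q+W)/2, R)` and, apart from
one unneeded component, with `(-Q, (R-P)/2, W)`. If `d ≠ 0`, these vectors are parallel to each
other, and two of their minors combine to `(R-P)² + (W+Q)² = 0`. -/
theorem collinear_cross {P Q R W d0 d1 d2 : ℝ}
    (h1 : -((Q + W) / 2) * d0 - P * d1 = 0) (h2 : (R - P) / 2 * d0 + Q * d1 = 0)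
    (h3 : R * d0 - P * d2 = 0)
    (h5 : R * d1 + (Q + W) / 2 * d2 = 0) (h6 : W * d1 - (R - P) / 2 * d2 = 0)
    (hd : ¬(d0 = 0 ∧ d1 = 0 ∧ d2 = 0)) : R = P ∧ W = -Q := by
  have key : ∀ m : ℝ, d0 * m = 0 → d1 * m = 0 → d2 * m = 0 → m = 0 := by
    intro m m0 m1 m2
    by_contra hm
    exact hd ⟨(mul_eq_zero.mp m0).resolve_right hm, (mul_eq_zero.mp m1).resolve_right hm,
      (mul_eq_zero.mp m2).resolve_right hm⟩
  have m1 : P * ((R - P) / 2) - Q * ((Q + W) / 2) = 0 := by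
    apply key
    · linear_combination P * h2 + Q * h1
    · linear_combination -((R - P) / 2) * h1 - (Q + W) / 2 * h2
    · linear_combination -((R - P) / 2) * h3 - Q * h5 + R * h2
  have m3 : -((Q + W) / 2) * W - (R - P) / 2 * R = 0 := by
    apply key
    · linear_combination W * h1 - (R - P) / 2 * h3 + P * h6
    · linear_combination -((Q + W) / 2) * h6 - (R - P) / 2 * h5
    · linear_combination R * h6 - W * h5
  have h : (R - P) ^ 2 + (W + Q) ^ 2 = 0 := by linear_combination -2 * m1 - 2 * m3
  have hR : (R - P) ^ 2 = 0 := by nlinarith [sq_nonneg (R - P), sq_nonneg (W + Q)]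
  have hW : (W + Q) ^ 2 = 0 := by nlinarith [sq_nonneg (R - P), sq_nonneg (W + Q)]
  rw [sq_eq_zero_iff] at hR hW
  exact ⟨by linarith, by linarith⟩

/-- An accelerated shear-free axis is incompatible with anisotropic curvature. -/
theorem eq_zero_of_shearfree {b0 b1 b2 k0 k1 k2 r0 r1 r2 κ β : ℝ}
    (E1 : b0 * b1 - b0 * k0 / 2 - b0 * r0 / 2 + b1 * k1 - b1 * r1 - b2 * k0 / 2 + b2 * r0 / 2
      - k0 * r1 + k1 * r0 = 0)
    (E2 : -κ / 2 + b0 * r1 + b1 * k0 - b1 * r0 - k0 * k0 / 2 - k0 * k2 / 2 - k0 * r0 / 2 + k1 * k1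
      - k1 * r1 + k2 * r0 / 2 + β = 0)
    (E3 : κ + 2 * b0 * b2 - b1 * k0 + b1 * k2 - b1 * r0 - b1 * r2 - k0 * r2 + k2 * r0 - 2 * β = 0)
    (E4 : b0 * k2 + b0 * r2 + b2 * k0 - b2 * r0 - k0 * k1 + k1 * k2 - k1 * r0 - k1 * r2 = 0)
    (E5 : b0 * k2 / 2 + b0 * r2 / 2 + b1 * b2 - b1 * k1 - b1 * r1 + b2 * k2 / 2 - b2 * r2 / 2
      - k1 * r2 + k2 * r1 = 0)
    (E6 : κ / 2 + b1 * k2 + b1 * r2 - b2 * r1 + k0 * k2 / 2 + k0 * r2 / 2 - k1 * k1 - k1 * r1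
      + k2 * k2 / 2 - k2 * r2 / 2 - β = 0)
    (E7 : -κ + b0 * k1 - b1 * k0 + b1 * r0 - k0 * r0 / 2 - k0 * r2 / 2 - r0 * r0 / 2 + r0 * r2
      - 2 * (r1 * r1) + b1 * k2 + b1 * r2 - b2 * k1 + k2 * r0 / 2 + k2 * r2 / 2 - r2 * r2 / 2 = 0)
    (hk2 : k2 - b1 = b1 + k0) (hb2 : b2 + k1 = b0 - k1)
    (hne : ¬(b1 + k0 = 0 ∧ b0 - k1 = 0)) : β = 0 := by
  obtain rfl : k2 = k0 + 2 * b1 := by linarith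
  obtain rfl : b2 = b0 - 2 * k1 := by linarith
  -- In the shear-free case `b1` measures the twist of the axis and `(b1 + k0, b0 - k1)` its
  -- acceleration. The equations force twist times acceleration to vanish.
  have hb1 : b1 = 0 := by
    have h1 : b1 * (b1 + k0) = 0 := by linear_combination (E2 + E6) / 4
    have h2 : b1 * (b0 - k1) = 0 := by linear_combination (E1 + E5) / 4
    by_contra hb
    exact hne ⟨(mul_eq_zero.mp h1).resolve_left hb, (mul_eq_zero.mp h2).resolve_left hb⟩
  subst hb1
  have h1 : k0 * (b0 - k1 + r1) = 0 := by linear_combination -E1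
  have h2 : (b0 - k1) * (r0 - r2 - 2 * k0) = 0 := by linear_combination -E4
  have h3 : 2 * (b0 - k1) * (b0 - k1 + r1) + k0 * (r0 - r2 - 2 * k0) = 0 := by
    linear_combination E3 + 2 * E2
  -- The nonzero acceleration `(k0, b0 - k1)` determines the two spin combinations that enter.
  have h4 : b0 - k1 + r1 = 0 ∧ r0 - r2 - 2 * k0 = 0 := by
    by_cases hQ : b0 - k1 = 0
    · have hk : k0 ≠ 0 := fun hk => hne ⟨by linarith, hQ⟩
      refine ⟨(mul_eq_zero.mp h1).resolve_left hk, ?_⟩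
      rw [hQ] at h3
      simpa [hk] using h3
    · have h5 := (mul_eq_zero.mp h2).resolve_left hQ
      rw [h5] at h3
      refine ⟨?_, h5⟩
      simpa [hQ] using h3
  obtain ⟨h5, h6⟩ := h4
  have hr1 : r1 = k1 - b0 := by linarith
  have hr0 : r0 = r2 + 2 * k0 := by linarith
  subst hr1 hr0
  -- Both equations contain `-κ`, so `κ` drops out; with the spin substituted only `β` survives.
  linear_combination (E7 - 2 * E2) / (-2)

/-- The part of a skew endomorphism that moves `ℓ + n`. -/
def boostMatrix (b k : ℝ) : Matrix (Fin 3) (Fin 3) ℝ := !![b, k / 2, 0; k, 0, k; 0, k / 2, -b]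

/-- The four conditions say that `∇u` has neither acceleration nor shear. Expansion and twist, which
remain, commute with the rotations about the axis. -/
theorem boostMatrix_equivariant {b k : Fin 3 → ℝ} (h1 : b 1 + k 0 = 0) (h2 : b 0 - k 1 = 0)
    (h3 : k 2 - b 1 = 0) (h4 : b 2 + k 1 = 0) (c : Fin 3) :
    boostMatrix (b c) (k c) * axialRotation
        + ∑ i, axialRotation i c • boostMatrix (b i) (k i)
      = axialRotation * boostMatrix (b c) (k c) := by
  have e1 : k 0 = -b 1 := by linarith
  have e2 : k 1 = b 0 := by linarith
  have e3 : k 2 = b 1 := by linarith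
  have e4 : b 2 = -b 0 := by linarith
  ext i j
  fin_cases c <;> fin_cases i <;> fin_cases j <;>
    simp [boostMatrix, axialRotation, Fin.sum_univ_three, e1, e2, e3, e4] <;>
    try ring

/-! ### Splitting the connection at the axis -/

namespace MovingFrame

variable (e : MovingFrame g)

/-- The connection matrix in the direction `e_c`. -/
def connMatrix (c : Fin 3) (x : M) : Matrix (Fin 3) (Fin 3) ℝ := fun b a => e.conn b a c x

theorem connMatrix_skew (c : Fin 3) (x : M) (a b : Fin 3) :
    ∑ m, e.connMatrix c x m a * eta m b + ∑ m, e.connMatrix c x m b * eta a m = 0 := by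
  have h1 := e.connLow_eq_sum b a c x
  have h2 := e.connLow_eq_sum a b c x
  have h3 := e.connLow_antisymm a b c x
  simp only [connMatrix, Fin.sum_univ_three] at *
  rw [eta_symm 0 b, eta_symm 1 b, eta_symm 2 b]
  linarith

/-- The component of the connection that is not determined by the derivative of the axis. -/
def spin (c : Fin 3) (x : M) : ℝ := e.connLow 1 2 c x + e.connLow 0 1 c x

/-- The remaining connection components besides `Γ_{02c}`. -/
def tilt (c : Fin 3) (x : M) : ℝ := e.connLow 1 2 c x - e.connLow 0 1 c x

theorem conn_zero (a c : Fin 3) (x : M) : e.conn 0 a c x = -e.connLow 2 a c x := by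
  simp [conn, Fin.sum_univ_three, etaInv]

theorem conn_one (a c : Fin 3) (x : M) : e.conn 1 a c x = 2 * e.connLow 1 a c x := by
  simp [conn, Fin.sum_univ_three, etaInv]

theorem conn_two (a c : Fin 3) (x : M) : e.conn 2 a c x = -e.connLow 0 a c x := by
  simp [conn, Fin.sum_univ_three, etaInv]

theorem connLow_self (a c : Fin 3) (x : M) : e.connLow a a c x = 0 := by
  linarith [e.connLow_antisymm a a c x]

/-- The rotation part annihilates axial tensors, so the first covariant derivative of the curvature
does not see `spin`. -/
theorem connMatrix_eq (c : Fin 3) (x : M) :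
    e.connMatrix c x = boostMatrix (e.connLow 0 2 c x) (e.tilt c x)
      + (e.spin c x / 2) • axialRotation := by
  ext i j
  have h10 := e.connLow_antisymm 1 0 c x
  have h20 := e.connLow_antisymm 2 0 c x
  have h21 := e.connLow_antisymm 2 1 c x
  fin_cases i <;> fin_cases j <;>
    simp [connMatrix, conn_zero, conn_one, conn_two, connLow_self, boostMatrix, axialRotation,
      tilt, spin, h10, h20, h21] <;> ring

theorem covDeriv_snoc {k : ℕ} (T : M → Tensor k) (x : M) (a : Fin k → Fin 3) (c : Fin 3) :
    e.covDeriv T x (Fin.snoc a c)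
      = e.frameDeriv c (fun y => T y a) x - deriveTensor (e.connMatrix c x) (T x) a := by
  simp only [covDeriv, Fin.init_snoc, Fin.snoc_last, deriveTensor, connMatrix]

theorem frameDeriv_eq_zero_of_const {N : Set M} (hN : IsOpen N) {x : M} (hx : x ∈ N) {f : M → ℝ}
    {r : ℝ} (hf : ∀ y ∈ N, f y = r) (c : Fin 3) : e.frameDeriv c f x = 0 := by
  rw [e.frameDeriv_congr c hN hx (f' := fun _ => r) hf, frameDeriv_const]

theorem covDeriv_snoc_of_const {k : ℕ} {T : M → Tensor k} {T₀ : Tensor k} {N : Set M}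
    (hN : IsOpen N) (hT : ∀ y ∈ N, T y = T₀) {x : M} (hx : x ∈ N) (a : Fin k → Fin 3) (c : Fin 3) :
    e.covDeriv T x (Fin.snoc a c) = -deriveTensor (e.connMatrix c x) T₀ a := by
  rw [covDeriv_snoc, e.frameDeriv_eq_zero_of_const hN hx (r := T₀ a) fun y hy => by rw [hT y hy],
    hT x hx, zero_sub]

end MovingFrame

/-! ### Structure equations and rigidity of the second covariant derivative -/

namespace MovingFrame

variable (e : MovingFrame g)

/-- The structure equations for the connection in a frame in which the boost components
`b c = Γ_{02c}` and `k c = Γ_{12c} - Γ_{01c}` are constant and the curvature is axial. -/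
theorem structure_equations {N : Set M} (hN : IsOpen N) (hNe : N ⊆ e.domain) {κ β : ℝ}
    (hR : ∀ y ∈ N, ∀ a b c d, e.riemann a b c d y = axialCurvature κ β a b c d)
    {b k : Fin 3 → ℝ} (hb : ∀ c, ∀ y ∈ N, e.connLow 0 2 c y = b c)
    (hk : ∀ c, ∀ y ∈ N, e.tilt c y = k c) {y : M} (hy : y ∈ N) {r : Fin 3 → ℝ}
    (hr : ∀ c, e.spin c y = r c) :
    b 0 * b 1 - b 0 * k 0 / 2 - b 0 * r 0 / 2 + b 1 * k 1 - b 1 * r 1 - b 2 * k 0 / 2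
        + b 2 * r 0 / 2 - k 0 * r 1 + k 1 * r 0 = 0 ∧
    -κ / 2 + b 0 * r 1 + b 1 * k 0 - b 1 * r 0 - k 0 * k 0 / 2 - k 0 * k 2 / 2 - k 0 * r 0 / 2
        + k 1 * k 1 - k 1 * r 1 + k 2 * r 0 / 2 + β = 0 ∧
    κ + 2 * b 0 * b 2 - b 1 * k 0 + b 1 * k 2 - b 1 * r 0 - b 1 * r 2 - k 0 * r 2 + k 2 * r 0
        - 2 * β = 0 ∧
    b 0 * k 2 + b 0 * r 2 + b 2 * k 0 - b 2 * r 0 - k 0 * k 1 + k 1 * k 2 - k 1 * r 0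
        - k 1 * r 2 = 0 ∧
    b 0 * k 2 / 2 + b 0 * r 2 / 2 + b 1 * b 2 - b 1 * k 1 - b 1 * r 1 + b 2 * k 2 / 2
        - b 2 * r 2 / 2 - k 1 * r 2 + k 2 * r 1 = 0 ∧
    κ / 2 + b 1 * k 2 + b 1 * r 2 - b 2 * r 1 + k 0 * k 2 / 2 + k 0 * r 2 / 2 - k 1 * k 1
        - k 1 * r 1 + k 2 * k 2 / 2 - k 2 * r 2 / 2 - β = 0 ∧
    e.frameDeriv 0 (e.spin 1) y - e.frameDeriv 1 (e.spin 0) y + e.frameDeriv 1 (e.spin 2) y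
        - e.frameDeriv 2 (e.spin 1) y
        + (-κ + b 0 * k 1 - b 1 * k 0 + b 1 * r 0 - k 0 * r 0 / 2 - k 0 * r 2 / 2 - r 0 * r 0 / 2
        + r 0 * r 2 - 2 * (r 1 * r 1) + b 1 * k 2 + b 1 * r 2 - b 2 * k 1 + k 2 * r 0 / 2
        + k 2 * r 2 / 2 - r 2 * r 2 / 2) = 0 := by
  have hye := hNe hy
  have hB : ∀ c, e.connLow 0 2 c y = b c := fun c => hb c y hy
  have hA : ∀ c, e.connLow 0 1 c y = (r c - k c) / 2 := fun c => by
    have h1 := hk c y hy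
    have h2 := hr c
    simp only [tilt, spin] at h1 h2
    linarith
  have hC : ∀ c, e.connLow 1 2 c y = (r c + k c) / 2 := fun c => by
    have h1 := hk c y hy
    have h2 := hr c
    simp only [tilt, spin] at h1 h2
    linarith
  have hd := e.isDiffAt_connLow hye
  have hDB : ∀ c d, e.frameDeriv d (e.connLow 0 2 c) y = 0 := fun c d =>
    e.frameDeriv_eq_zero_of_const hN hy (hb c) d
  -- Constancy of `tilt` makes the derivatives of `Γ_{12c}` and `Γ_{01c}` equal, so they cancel in
  -- the differences of curvature equations taken at the end.
  have hDk : ∀ c d, e.frameDeriv d (e.connLow 1 2 c) y = e.frameDeriv d (e.connLow 0 1 c) y :=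
    fun c d => by
      have h1 := e.frameDeriv_eq_zero_of_const hN hy (hk c) d
      have h2 := e.frameDeriv_sub d (hd 1 2 c) (hd 0 1 c)
      exact sub_eq_zero.mp (h2.symm.trans h1)
  have hDs : ∀ c d, e.frameDeriv d (e.spin c) y
      = e.frameDeriv d (e.connLow 1 2 c) y + e.frameDeriv d (e.connLow 0 1 c) y := fun c d =>
    e.frameDeriv_add d (hd 1 2 c) (hd 0 1 c)
  have h10 := fun c => e.connLow_antisymm 1 0 c y
  have h20 := fun c => e.connLow_antisymm 2 0 c y
  have h21 := fun c => e.connLow_antisymm 2 1 c y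
  have eq := fun a b c d => (e.riemann_eq hye a b c d).symm.trans (hR y hy a b c d)
  have e0101 := eq 0 1 0 1
  have e0102 := eq 0 1 0 2
  have e0112 := eq 0 1 1 2
  have e0201 := eq 0 2 0 1
  have e0202 := eq 0 2 0 2
  have e0212 := eq 0 2 1 2
  have e1201 := eq 1 2 0 1
  have e1202 := eq 1 2 0 2
  have e1212 := eq 1 2 1 2
  clear eq
  simp only [Fin.sum_univ_three, conn_zero, conn_one, conn_two, connLow_self, h10, h20, h21, hA, hB,
    hC, hDB, hDk] at e0101 e0102 e0112 e0201 e0202 e0212 e1201 e1202 e1212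
  have t1 : axialCurvature κ β 0 1 0 1 = β / 2 := by simp [axialCurvature, eta, axis]; ring
  have t2 : axialCurvature κ β 0 1 0 2 = 0 := by simp [axialCurvature, eta, axis]
  have t3 : axialCurvature κ β 0 1 1 2 = κ / 2 - β / 2 := by
    simp [axialCurvature, eta, axis]; ring
  have t4 : axialCurvature κ β 0 2 0 1 = 0 := by simp [axialCurvature, eta, axis]
  have t5 : axialCurvature κ β 0 2 0 2 = -κ + 2 * β := by simp [axialCurvature, eta, axis]; ring
  have t6 : axialCurvature κ β 0 2 1 2 = 0 := by simp [axialCurvature, eta, axis]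
  have t7 : axialCurvature κ β 1 2 0 1 = κ / 2 - β / 2 := by
    simp [axialCurvature, eta, axis]; ring
  have t8 : axialCurvature κ β 1 2 0 2 = 0 := by simp [axialCurvature, eta, axis]
  have t9 : axialCurvature κ β 1 2 1 2 = β / 2 := by simp [axialCurvature, eta, axis]; ring
  rw [t1] at e0101
  rw [t2] at e0102
  rw [t3] at e0112
  rw [t4] at e0201
  rw [t5] at e0202
  rw [t6] at e0212
  rw [t7] at e1201
  rw [t8] at e1202
  rw [t9] at e1212
  simp only [hDs, hDk]
  -- Six derivative-free relations come from the index pair 02 and from the differences of the pairs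
  -- 12 and 01. The last relation is a sum in which derivatives of the spin survive.
  refine ⟨?_, ?_, ?_, ?_, ?_, ?_, ?_⟩
  · linear_combination e0201
  · linear_combination e1201 - e0101
  · linear_combination e0202
  · linear_combination e1202 - e0102
  · linear_combination e0212
  · linear_combination e1212 - e0112
  · linear_combination e1201 + e0101 + e1212 + e0112

/-- If the curvature is axial with nonzero anisotropy and it and its first covariant derivative have
constant components, then so does the second covariant derivative. -/
theorem curvatureDeriv_two_const {N : Set M} (hN : IsOpen N) (hNe : N ⊆ e.domain) {κ β : ℝ}
    (hβ : β ≠ 0) (hR : ∀ y ∈ N, ∀ a b c d, e.riemann a b c d y = axialCurvature κ β a b c d)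
    {T₁ : Tensor (4 + 1)} (hT₁ : ∀ y ∈ N, e.curvatureDeriv 1 y = T₁) {x : M} (hx : x ∈ N) :
    ∀ y ∈ N, e.curvatureDeriv 2 y = e.curvatureDeriv 2 x := by
  set T₀ : Tensor 4 := fun a => axialCurvature κ β (a 0) (a 1) (a 2) (a 3) with hT₀
  have hT₀' : ∀ y ∈ N, e.curvatureDeriv 0 y = T₀ := fun y hy => funext fun a => hR y hy _ _ _ _
  have hT₁' : ∀ y ∈ N, ∀ (a : Fin 4 → Fin 3) c,
      T₁ (Fin.snoc a c) = -deriveTensor (e.connMatrix c y) T₀ a := fun y hy a c => by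
    rw [← hT₁ y hy]
    exact e.covDeriv_snoc_of_const hN hT₀' hy a c
  have hv : ∀ y ∈ N, ∀ a b c d f, T₁ (Fin.snoc ![a, b, c, d] f)
      = -(β * (eta a c * ((∑ m, e.connMatrix f y m b * axis m) * axis d
          + axis b * ∑ m, e.connMatrix f y m d * axis m)
        - eta a d * ((∑ m, e.connMatrix f y m b * axis m) * axis c
          + axis b * ∑ m, e.connMatrix f y m c * axis m)
        + eta b d * ((∑ m, e.connMatrix f y m a * axis m) * axis c
          + axis a * ∑ m, e.connMatrix f y m c * axis m)
        - eta b c * ((∑ m, e.connMatrix f y m a * axis m) * axis d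
          + axis a * ∑ m, e.connMatrix f y m d * axis m))) := by
    intro y hy a b c d f
    rw [hT₁' y hy, ← derive_axialCurvature (e.connMatrix_skew f y) κ β a b c d, hT₀,
      deriveTensor_four]
    rfl
  have hva : ∀ y c, ∑ m, e.connMatrix c y m 0 * axis m = e.connLow 0 2 c y := by
    intro y c
    have h20 := e.connLow_antisymm 2 0 c y
    simp [connMatrix, Fin.sum_univ_three, axis, conn_zero, conn_two, connLow_self, h20]
  have hvb : ∀ y c, ∑ m, e.connMatrix c y m 1 * axis m = e.tilt c y := by
    intro y c
    have h21 := e.connLow_antisymm 2 1 c y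
    simp [connMatrix, Fin.sum_univ_three, axis, conn_zero, conn_two, h21, tilt]
    ring
  -- The component `R_{0101;c}` equals `-β Γ_{02c}`, and `R_{0102;c}`, used next, equals `-β` times
  -- the tilt; division by `β ≠ 0` transfers constancy.
  have hb : ∀ c, ∀ y ∈ N, e.connLow 0 2 c y = e.connLow 0 2 c x := by
    intro c y hy
    have h1 := (hv y hy 0 1 0 1 c).symm.trans (hv x hx 0 1 0 1 c)
    simp only [hva, hvb] at h1
    simp [eta, axis] at h1
    rcases h1 with h1 | h1
    · linarith
    · exact absurd h1 hβ
  have hk : ∀ c, ∀ y ∈ N, e.tilt c y = e.tilt c x := by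
    intro c y hy
    have h1 := (hv y hy 0 1 0 2 c).symm.trans (hv x hx 0 1 0 2 c)
    simp only [hva, hvb] at h1
    simp [eta, axis] at h1
    rcases h1 with h1 | h1
    · linarith
    · exact absurd h1 hβ
  have hT₂ : ∀ y ∈ N, ∀ (a : Fin 5 → Fin 3) c, e.curvatureDeriv 2 y (Fin.snoc a c)
      = -(deriveTensor (boostMatrix (e.connLow 0 2 c x) (e.tilt c x)) T₁ a
        + e.spin c y / 2 * deriveTensor axialRotation T₁ a) := by
    intro y hy a c
    refine (e.covDeriv_snoc_of_const hN hT₁ hy a c).trans ?_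
    rw [connMatrix_eq, hb c y hy, hk c y hy, deriveTensor_add, deriveTensor_smul]
    rfl
  -- The only possible non-constant factor in `hT₂` is the spin, so it suffices that the spin is
  -- constant or that its coefficient vanishes.
  have hsuff : (deriveTensor axialRotation T₁ = 0 ∨ ∀ y ∈ N, ∀ c, e.spin c y = e.spin c x) →
      ∀ y ∈ N, e.curvatureDeriv 2 y = e.curvatureDeriv 2 x := by
    intro h y hy
    funext a
    obtain ⟨a, c, rfl⟩ : ∃ (a' : Fin 5 → Fin 3) (c : Fin 3),
        a = (Fin.snoc a' c : Fin (5 + 1) → Fin 3) :=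
      ⟨Fin.init (n := 5) a, a (Fin.last 5), (Fin.snoc_init_self (n := 5) a).symm⟩
    refine (hT₂ y hy a c).trans (Eq.trans ?_ (hT₂ x hx a c).symm)
    rcases h with h | h
    · rw [h]; simp
    · rw [h y hy c]
  apply hsuff
  set b : Fin 3 → ℝ := fun c => e.connLow 0 2 c x with hbdef
  set k : Fin 3 → ℝ := fun c => e.tilt c x with hkdef
  have hE := fun y hy => e.structure_equations hN hNe hR hb hk (y := y) hy
    (r := fun c => e.spin c y) fun c => rfl
  by_cases hinv : (b 1 + k 0 = 0 ∧ b 0 - k 1 = 0) ∧ k 2 - b 1 = 0 ∧ b 2 + k 1 = 0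
  · left
    refine deriveTensor_eq_zero_of_equivariant (B := fun c => boostMatrix (b c) (k c))
      (T := T₀) (fun a c => ?_) (derive_axialRotation_axialCurvature κ β)
      (boostMatrix_equivariant hinv.1.1 hinv.1.2 hinv.2.1 hinv.2.2)
    rw [hT₁' x hx, connMatrix_eq, deriveTensor_add, deriveTensor_smul,
      derive_axialRotation_axialCurvature κ β]
    simp [b, k]
  right
  -- the differences of the spin coefficients solve a homogeneous linear system
  have hlin : ∀ y ∈ N,
      -((b 0 - k 1 + -(b 2 + k 1)) / 2) * (e.spin 0 y - e.spin 0 x)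
        - (b 1 + k 0) * (e.spin 1 y - e.spin 1 x) = 0 ∧
      (k 2 - b 1 - (b 1 + k 0)) / 2 * (e.spin 0 y - e.spin 0 x)
        + (b 0 - k 1) * (e.spin 1 y - e.spin 1 x) = 0 ∧
      (k 2 - b 1) * (e.spin 0 y - e.spin 0 x) - (b 1 + k 0) * (e.spin 2 y - e.spin 2 x) = 0 ∧
      -(b 2 + k 1) * (e.spin 0 y - e.spin 0 x) + (b 0 - k 1) * (e.spin 2 y - e.spin 2 x) = 0 ∧
      (k 2 - b 1) * (e.spin 1 y - e.spin 1 x)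
        + (b 0 - k 1 + -(b 2 + k 1)) / 2 * (e.spin 2 y - e.spin 2 x) = 0 ∧
      -(b 2 + k 1) * (e.spin 1 y - e.spin 1 x)
        - (k 2 - b 1 - (b 1 + k 0)) / 2 * (e.spin 2 y - e.spin 2 x) = 0 := by
    intro y hy
    obtain ⟨E1, E2, E3, E4, E5, E6, -⟩ := hE y hy
    obtain ⟨F1, F2, F3, F4, F5, F6, -⟩ := hE x hx
    refine ⟨?_, ?_, ?_, ?_, ?_, ?_⟩
    · linear_combination E1 - F1
    · linear_combination E2 - F2
    · linear_combination E3 - F3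
    · linear_combination E4 - F4
    · linear_combination E5 - F5
    · linear_combination E6 - F6
  -- These equalities say that the axis is shear-free; as `hinv` fails, it is then accelerated.
  by_cases hsf : k 2 - b 1 = b 1 + k 0 ∧ -(b 2 + k 1) = -(b 0 - k 1)
  · exfalso
    obtain ⟨hs1, hs2⟩ := hsf
    have hs2' : b 2 + k 1 = b 0 - k 1 := by linarith
    have hne : ¬(b 1 + k 0 = 0 ∧ b 0 - k 1 = 0) := fun h =>
      hinv ⟨h, hs1.trans h.1, hs2'.trans h.2⟩
    -- The linear system now permits the spin to vary only in the direction `(1, 0, 1)`.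
    have hcon : ∀ y ∈ N, e.spin 1 y = e.spin 1 x ∧
        e.spin 0 y - e.spin 2 y = e.spin 0 x - e.spin 2 x := by
      intro y hy
      obtain ⟨L1, L2, L3, L4, -, -⟩ := hlin y hy
      rw [hs1] at L2 L3
      rw [hs2] at L1 L4
      by_cases hP : b 1 + k 0 = 0
      · have hQ : b 0 - k 1 ≠ 0 := fun hQ => hne ⟨hP, hQ⟩
        constructor
        · have := (mul_eq_zero.mp (show (b 0 - k 1) * (e.spin 1 y - e.spin 1 x) = 0 by
            linear_combination L2)).resolve_left hQ
          linarith
        · have := (mul_eq_zero.mp (show (b 0 - k 1) * ((e.spin 0 y - e.spin 0 x)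
            - (e.spin 2 y - e.spin 2 x)) = 0 by linear_combination -L4)).resolve_left hQ
          linarith
      · constructor
        · have := (mul_eq_zero.mp (show (b 1 + k 0) * (e.spin 1 y - e.spin 1 x) = 0 by
            linear_combination -L1)).resolve_left hP
          linarith
        · have := (mul_eq_zero.mp (show (b 1 + k 0) * ((e.spin 0 y - e.spin 0 x)
            - (e.spin 2 y - e.spin 2 x)) = 0 by linear_combination L3)).resolve_left hP
          linarith
    obtain ⟨E1, E2, E3, E4, E5, E6, E7⟩ := hE x hx
    have hd : ∀ c, IsDiffAt (e.spin c) x := fun c =>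
      MDifferentiableAt.add (e.isDiffAt_connLow (hNe hx) 1 2 c)
        (e.isDiffAt_connLow (hNe hx) 0 1 c)
    -- The differential structure equation involves only derivatives of `spin 1` and the derivative
    -- of `spin 0 - spin 2` along `e₁`, all of which vanish.
    have hD1 := fun c => e.frameDeriv_eq_zero_of_const hN hx (fun y hy => (hcon y hy).1) c
    have hD02 : e.frameDeriv 1 (e.spin 0) x - e.frameDeriv 1 (e.spin 2) x = 0 :=
      (e.frameDeriv_sub 1 (hd 0) (hd 2)).symm.trans
        (e.frameDeriv_eq_zero_of_const hN hx (fun y hy => (hcon y hy).2) 1)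
    refine hβ (eq_zero_of_shearfree E1 E2 E3 E4 E5 E6 ?_ hs1 hs2' hne)
    linear_combination E7 - hD1 0 + hD1 2 + hD02
  · intro y hy
    obtain ⟨L1, L2, L3, -, L5, L6⟩ := hlin y hy
    have h0 := not_imp_comm.mp (collinear_cross L1 L2 L3 L5 L6) hsf
    intro c
    fin_cases c
    · exact sub_eq_zero.mp h0.1
    · exact sub_eq_zero.mp h0.2.1
    · exact sub_eq_zero.mp h0.2.2

end MovingFrame

/-! ### Local constancy -/

theorem exists_const_of_mfderiv_eq_zero {F : Type*} [NormedAddCommGroup F] [NormedSpace ℝ F]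
    {f : M → F} {U : Set M} (hU : IsOpen U)
    (hd : ∀ y ∈ U, MDifferentiableAt (𝓡 3) 𝓘(ℝ, F) f y)
    (h0 : ∀ y ∈ U, mfderiv (𝓡 3) 𝓘(ℝ, F) f y = 0) {x : M} (hx : x ∈ U) :
    ∃ N ⊆ U, IsOpen N ∧ x ∈ N ∧ ∀ y ∈ N, f y = f x := by
  set φ := extChartAt (𝓡 3) x with hφ
  have hV : IsOpen (φ.target ∩ φ.symm ⁻¹' U) :=
    (continuousOn_extChartAt_symm x).isOpen_inter_preimage (isOpen_extChartAt_target x) hU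
  have hxV : φ x ∈ φ.target ∩ φ.symm ⁻¹' U := by
    refine ⟨mem_extChartAt_target x, ?_⟩
    rw [Set.mem_preimage, hφ, extChartAt_to_inv]
    exact hx
  obtain ⟨ε, hε, hball⟩ := Metric.isOpen_iff.mp hV _ hxV
  have hG : ∀ z ∈ Metric.ball (φ x) ε, HasFDerivAt (f ∘ φ.symm)
      (0 : EuclideanSpace ℝ (Fin 3) →L[ℝ] F) z := by
    intro z hz
    have hzV := hball hz
    have h1 : HasMFDerivAt (𝓡 3) 𝓘(ℝ, F) f (φ.symm z) 0 := by
      rw [← h0 _ hzV.2]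
      exact (hd _ hzV.2).hasMFDerivAt
    have h2 : MDifferentiableAt 𝓘(ℝ, EuclideanSpace ℝ (Fin 3)) (𝓡 3) φ.symm z :=
      (mdifferentiableWithinAt_extChartAt_symm hzV.1).mdifferentiableAt (by simp)
    have h3 := h1.comp z h2.hasMFDerivAt
    rw [ContinuousLinearMap.zero_comp] at h3
    exact hasMFDerivAt_iff_hasFDerivAt.mp h3
  refine ⟨φ.source ∩ φ ⁻¹' Metric.ball (φ x) ε, ?_, ?_, ?_, ?_⟩
  · rintro y ⟨hy, hyb⟩
    have := (hball hyb).2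
    rwa [Set.mem_preimage, φ.left_inv hy] at this
  · exact (continuousOn_extChartAt x).isOpen_inter_preimage (isOpen_extChartAt_source x)
      Metric.isOpen_ball
  · exact ⟨mem_extChartAt_source x, Metric.mem_ball_self hε⟩
  · rintro y ⟨hy, hyb⟩
    have := Metric.isOpen_ball.is_const_of_fderiv_eq_zero
      (convex_ball (φ x) ε).isPreconnected
      (fun z hz => (hG z hz).differentiableAt.differentiableWithinAt)
      (fun z hz => (hG z hz).fderiv) hyb (Metric.mem_ball_self hε)
    simp only [Function.comp_apply, φ.left_inv hy, φ.left_inv (mem_extChartAt_source x)] at this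
    exact this

namespace MovingFrame

theorem exists_const_of_jetRank_eq_zero (e : MovingFrame g) {p : ℕ}
    (h : ∀ y ∈ e.domain, e.jetRank p y = 0) {x : M} (hx : x ∈ e.domain) :
    ∃ N ⊆ e.domain, IsOpen N ∧ x ∈ N ∧ ∀ y ∈ N, e.curvatureJet p y = e.curvatureJet p x := by
  refine exists_const_of_mfderiv_eq_zero e.isOpen_domain
    (fun y hy => e.mdifferentiableAt_curvatureJet p hy) (fun y hy => ?_) hx
  have h1 := h y hy
  have : FiniteDimensional ℝ (TangentSpace (𝓡 3) y) :=
    inferInstanceAs (FiniteDimensional ℝ (EuclideanSpace ℝ (Fin 3)))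
  rw [jetRank, Submodule.finrank_eq_zero, LinearMap.range_eq_bot] at h1
  exact ContinuousLinearMap.coe_injective h1

theorem jetRank_eq_zero_of_const (e : MovingFrame g) {p : ℕ} {N : Set M} (hN : IsOpen N) {x : M}
    (hx : x ∈ N) (h : ∀ y ∈ N, e.curvatureJet p y = e.curvatureJet p x) : e.jetRank p x = 0 := by
  have h1 : e.curvatureJet p =ᶠ[nhds x] fun _ => e.curvatureJet p x :=
    Filter.eventuallyEq_of_mem (hN.mem_nhds hx) h
  rw [jetRank, h1.mfderiv_eq, mfderiv_const]
  exact (congrArg (fun W : Submodule ℝ (CurvatureSpace p) => Module.finrank ℝ W)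
    LinearMap.range_zero).trans (finrank_bot ℝ _)

/-! ### Rotated frames -/

/-- The frame `e_a = Y^b_a f_b` for a constant Lorentz matrix `Y`. -/
def rotate (f : MovingFrame g) (Y : Matrix (Fin 3) (Fin 3) ℝ) (hY : Yᵀ * eta * Y = eta) :
    MovingFrame g where
  domain := f.domain
  isOpen_domain := f.isOpen_domain
  vec a x := ∑ b, Y b a • f.vec b x
  smooth a x hx := ContMDiffWithinAt.sum_section fun b _ =>
    ContMDiffWithinAt.const_smul_section (f.smooth b x hx)
  inner_eq x hx a b := by
    rw [← congrFun (congrFun hY a) b]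
    simp only [map_add, map_smul, add_apply, smul_apply, smul_eq_mul, f.inner_eq x hx,
      Matrix.mul_apply, Matrix.transpose_apply, Fin.sum_univ_three]
    ring

theorem transition_eq (e h : MovingFrame g) {x : M} (hx : x ∈ h.domain) {a : Fin 3} {c : Fin 3 → ℝ}
    (hv : e.vec a x = ∑ b, c b • h.vec b x) (b : Fin 3) : e.transition h b a x = c b :=
  congrFun (h.coeff_eq_of_sum_eq hx ((e.vec_eq_sum_transition h hx a).symm.trans hv)) b

theorem curvatureDeriv_rotate (f : MovingFrame g) (Y : Matrix (Fin 3) (Fin 3) ℝ)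
    (hY : Yᵀ * eta * Y = eta) (k : ℕ) {x : M} (hx : x ∈ f.domain) :
    (f.rotate Y hY).curvatureDeriv k x = pull Y (f.curvatureDeriv k x) := by
  rw [curvatureDeriv_transition (f.rotate Y hY) f k ⟨hx, hx⟩]
  congr 1
  funext b a
  exact transition_eq _ f hx (c := fun b => Y b a) rfl b

end MovingFrame

/-- The coefficients of a real quartic with a pair of conjugate double roots. -/
theorem quartic_coeff {a0 a1 a2 a3 a4 : ℝ} {w : ℂ}
    (h : ∀ z : ℂ, (a0 : ℂ) + 4 * (a1 : ℂ) * z + 6 * (a2 : ℂ) * z ^ 2 + 4 * (a3 : ℂ) * z ^ 3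
      + (a4 : ℂ) * z ^ 4 = (a4 : ℂ) * (z - w) ^ 2 * (z - (starRingEnd ℂ) w) ^ 2) :
    a0 = a4 * (w.re ^ 2 + w.im ^ 2) ^ 2 ∧ a1 = -(a4 * w.re * (w.re ^ 2 + w.im ^ 2)) ∧
      a2 = a4 * (3 * w.re ^ 2 + w.im ^ 2) / 3 ∧ a3 = -(a4 * w.re) := by
  have hr : ∀ t : ℝ, a0 + 4 * a1 * t + 6 * a2 * t ^ 2 + 4 * a3 * t ^ 3 + a4 * t ^ 4
      = a4 * ((t - w.re) ^ 2 + w.im ^ 2) ^ 2 := by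
    intro t
    have h1 : ((t : ℂ) - w) * ((t : ℂ) - (starRingEnd ℂ) w)
        = (((t - w.re) ^ 2 + w.im ^ 2 : ℝ) : ℂ) := by
      apply Complex.ext <;> (simp [pow_two]; try ring)
    have h2 := h t
    rw [mul_assoc (a4 : ℂ) (((t : ℂ) - w) ^ 2), ← mul_pow, h1] at h2
    exact_mod_cast h2
  -- The values at `0, ±1, ±2` determine the coefficients; the combinations below are the
  -- interpolation formulas.
  have t0 := hr 0
  have t1 := hr 1
  have t2 := hr (-1)
  have t3 := hr 2
  have t4 := hr (-2)
  refine ⟨?_, ?_, ?_, ?_⟩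
  · linear_combination t0
  · linear_combination (8 * (t1 - t2) - (t3 - t4)) / 48
  · linear_combination (16 * (t1 + t2) - (t3 + t4) - 30 * t0) / 144
  · linear_combination ((t3 - t4) - 2 * (t1 - t2)) / 48

/-! ### Canonical frames at points of type DZ -/

namespace LorentzianMetric

/-- At a point of type DZ every moving frame can be rotated into a canonical one. -/
theorem IsTypeDZAt.exists_canonical_rotate {x : M} (hDZ : g.IsTypeDZAt x) (f : MovingFrame g)
    (hx : x ∈ f.domain) : ∃ (Y : Matrix (Fin 3) (Fin 3) ℝ) (hY : Yᵀ * eta * Y = eta),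
      (f.rotate Y hY).psi 1 x = 0 ∧ (f.rotate Y hY).psi 3 x = 0 ∧
      (f.rotate Y hY).psi 0 x = 3 * (f.rotate Y hY).psi 2 x ∧
      (f.rotate Y hY).psi 4 x = 3 * (f.rotate Y hY).psi 2 x ∧ (f.rotate Y hY).psi 2 x ≠ 0 := by
  obtain ⟨e, hxe, h4, w, hw, hquartic⟩ := hDZ
  obtain ⟨h0, h1, h2, h3⟩ := quartic_coeff hquartic
  set p := w.re
  set q := w.im
  set r := e.psi 4 x with hr
  -- The quartic is the trace-free Ricci form evaluated on `ℓ + 2z m + z² n`. The null rotation by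
  -- `p` and scaling by `q` in `Z` substitute `z ↦ p + q z` and divide by `q²`. The roots `p ± iq`
  -- move to `±i`, and the quartic becomes `r q² (z² + 1)²`.
  set Z : Matrix (Fin 3) (Fin 3) ℝ := !![1 / q, 0, 0; 2 * p / q, 1, 0; p ^ 2 / q, p, q] with hZ
  have hZeta : Zᵀ * eta * Z = eta := by
    ext i j
    fin_cases i <;> fin_cases j <;>
      simp [hZ, eta, Matrix.mul_apply, Fin.sum_univ_three] <;> field_simp <;> ring
  have hX := e.transitionMatrix_eta f ⟨hxe, hx⟩
  set X := e.transitionMatrix f x with hXdef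
  have hY : (X * Z)ᵀ * eta * (X * Z) = eta := by
    rw [Matrix.transpose_mul]
    calc Zᵀ * Xᵀ * eta * (X * Z) = Zᵀ * (Xᵀ * eta * X) * Z := by simp only [Matrix.mul_assoc]
      _ = eta := by rw [hX, hZeta]
  refine ⟨X * Z, hY, ?_⟩
  set h := f.rotate (X * Z) hY with hh
  have hxh : x ∈ h.domain := hx
  have hvec : ∀ a, h.vec a x = ∑ c, Z c a • e.vec c x := by
    intro a
    have h1 : h.vec a x = ∑ b, (X * Z) b a • f.vec b x := rfl
    rw [h1]
    simp only [e.vec_eq_sum_transition f hx, Matrix.mul_apply, hXdef,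
      MovingFrame.transitionMatrix, Fin.sum_univ_three]
    module
  have htr : ∀ a c, h.transition e c a x = Z c a := fun a c =>
    h.transition_eq e hxe (hvec a) c
  have hS := fun a b => h.tracefreeRicci_transition e ⟨hxh, hxe⟩ a b
  simp only [htr] at hS
  have s10 := e.tracefreeRicci_symm hxe 1 0
  have s20 := e.tracefreeRicci_symm hxe 2 0
  have s21 := e.tracefreeRicci_symm hxe 2 1
  have s11 := e.tracefreeRicci_one_one hxe
  have s00 : e.tracefreeRicci 0 0 x = _ := h0
  have s01 : e.tracefreeRicci 0 1 x = _ := h1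
  have s02 : e.tracefreeRicci 0 2 x = _ := h2
  have s12 : e.tracefreeRicci 1 2 x = _ := h3
  have s22 : e.tracefreeRicci 2 2 x = r := rfl
  have p0 : h.psi 0 x = r * q ^ 2 := by
    change h.tracefreeRicci 0 0 x = _
    rw [hS]
    simp only [Fin.sum_univ_three, s10, s20, s21, s11, s00, s01, s02, s12, s22]
    simp [hZ]
    field_simp
    ring
  have p1 : h.psi 1 x = 0 := by
    change h.tracefreeRicci 0 1 x = _
    rw [hS]
    simp only [Fin.sum_univ_three, s10, s20, s21, s11, s00, s01, s02, s12, s22]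
    simp [hZ]
    field_simp
    ring
  have p2 : h.psi 2 x = r * q ^ 2 / 3 := by
    change h.tracefreeRicci 0 2 x = _
    rw [hS]
    simp only [Fin.sum_univ_three, s10, s20, s21, s11, s00, s01, s02, s12, s22]
    simp [hZ]
    field_simp
    ring
  have p3 : h.psi 3 x = 0 := by
    change h.tracefreeRicci 1 2 x = _
    rw [hS]
    simp only [Fin.sum_univ_three, s10, s20, s21, s11, s00, s01, s02, s12, s22]
    simp [hZ]
    ring
  have p4 : h.psi 4 x = r * q ^ 2 := by
    change h.tracefreeRicci 2 2 x = _
    rw [hS]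
    simp only [Fin.sum_univ_three, s10, s20, s21, s11, s00, s01, s02, s12, s22]
    simp [hZ]
    ring
  refine ⟨p1, p3, ?_, ?_, ?_⟩
  · rw [p0, p2]; ring
  · rw [p4, p2]; ring
  · rw [p2]
    have : r * q ^ 2 ≠ 0 := mul_ne_zero h4 (pow_ne_zero 2 hw)
    exact div_ne_zero this (by norm_num)

end LorentzianMetric

/-! ### Normalizing cross-sections -/

theorem pull_pull (A B : Matrix (Fin 3) (Fin 3) ℝ) {k : ℕ} (T : Tensor k) :
    pull A (pull B T) = pull (B * A) T := by
  funext a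
  simp only [pull, Finset.mul_sum]
  rw [Finset.sum_comm]
  refine Finset.sum_congr rfl fun c _ => ?_
  have h := Finset.prod_univ_sum (fun _ : Fin k => (Finset.univ : Finset (Fin 3)))
    fun i m => B (c i) m * A m (a i)
  rw [Fintype.piFinset_univ] at h
  simp only [Matrix.mul_apply]
  rw [h, Finset.sum_mul]
  refine Finset.sum_congr rfl fun b _ => ?_
  rw [Finset.prod_mul_distrib]
  ring

theorem curvatureAct_mul (X Y : GL (Fin 3) ℝ) {p : ℕ} (T : CurvatureSpace p) :
    curvatureAct (X * Y) T = curvatureAct X (curvatureAct Y T) := by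
  funext k
  change pull (X * Y)⁻¹.val (T k) = pull X⁻¹.val (pull Y⁻¹.val (T k))
  rw [pull_pull, mul_inv_rev, Units.val_mul]

/-- The action is by inverses, so the group element is the inverse of the transition matrix. One
element serves for all orders `p`. -/
theorem MovingFrame.exists_curvatureAct (e h : MovingFrame g) {x : M}
    (hx : x ∈ e.domain ∩ h.domain) : ∃ X ∈ lorentzGroup, ∀ p,
      e.curvatureJet p x = curvatureAct X (h.curvatureJet p x) := by
  have hX := e.transitionMatrix_eta h hx
  have hee : etaInv * eta = 1 := by
    ext i j; rw [Matrix.mul_apply, etaInv_mul_eta, Matrix.one_apply]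
  have h1 : (etaInv * (e.transitionMatrix h x)ᵀ * eta) * e.transitionMatrix h x = 1 := by
    rw [Matrix.mul_assoc, Matrix.mul_assoc, ← Matrix.mul_assoc _ eta, hX, hee]
  let U : GL (Fin 3) ℝ := ⟨e.transitionMatrix h x, _, mul_eq_one_comm.mp h1, h1⟩
  refine ⟨U⁻¹, lorentzGroup.inv_mem hX, fun p => ?_⟩
  funext k
  change _ = pull U⁻¹⁻¹.val (h.curvatureDeriv k x)
  rw [inv_inv]
  exact e.curvatureDeriv_transition h k hx

namespace LorentzianMetric

/-- An element carrying a point of `S` into `S` belongs to the distinguished subgroup by maximality,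
hence fixes that point. -/
theorem IsNormalizingCrossSection.eq_of_curvatureAct {p : ℕ} {S : Set (CurvatureSpace p)}
    (hS : g.IsNormalizingCrossSection S) {X : GL (Fin 3) ℝ} (hX : X ∈ lorentzGroup)
    {s t : CurvatureSpace p} (hs : s ∈ S) (ht : t ∈ S) (h : t = curvatureAct X s) : t = s := by
  obtain ⟨G, -, hfix, hmax⟩ := hS.exists_subgroup
  rw [h]
  exact hfix X (hmax X hX ⟨t, ⟨s, hs, h.symm⟩, ht⟩) s hs

theorem IsNormalizingCrossSection.curvatureJet_eq {p : ℕ} {S : Set (CurvatureSpace p)}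
    (hS : g.IsNormalizingCrossSection S) {e e' : MovingFrame g} (he : e.IsNormalized S)
    (he' : e'.IsNormalized S) {x : M} (hx : x ∈ e.domain) (hx' : x ∈ e'.domain) :
    e'.curvatureJet p x = e.curvatureJet p x := by
  obtain ⟨X, hX, h⟩ := e'.exists_curvatureAct e ⟨hx', hx⟩
  exact hS.eq_of_curvatureAct hX (he x hx) (he' x hx') (h p)

theorem jetRank_eq_zero_of_horizontalRank {p : ℕ} {S : Set (CurvatureSpace p)}
    (hr : g.horizontalRank S = 0) {e : MovingFrame g} (he : e.IsNormalized S) {x : M}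
    (hx : x ∈ e.domain) : e.jetRank p x = 0 := by
  -- The supremum of an unbounded set of naturals is 0 by convention, so the bound is needed to
  -- deduce anything from a vanishing rank.
  have hbdd : BddAbove {r | ∃ e : MovingFrame g, e.IsNormalized S ∧
      ∃ x ∈ e.domain, r = e.jetRank p x} := by
    refine ⟨3, ?_⟩
    rintro r ⟨e, -, x, -, rfl⟩
    exact e.jetRank_le p x
  have h := le_csSup hbdd ⟨e, he, x, hx, rfl⟩
  exact Nat.le_zero.mp (h.trans hr.le)

/-- Near every point of a `CH₁` geometry of type DZ there is a frame in which the curvature and its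
first two covariant derivatives have constant components. -/
theorem exists_frame_curvatureJet_two_const (hDZ : g.IsTypeDZ) (hCH : g.IsCH 1) (x : M) :
    ∃ (h : MovingFrame g), ∃ N ⊆ h.domain, IsOpen N ∧ x ∈ N ∧
      ∀ y ∈ N, h.curvatureJet 2 y = h.curvatureJet 2 x := by
  obtain ⟨-, S, hS, hr⟩ := hCH
  obtain ⟨f, hxf, hf⟩ := hS.cover x
  obtain ⟨N, hNf, hN, hxN, hconst⟩ := f.exists_const_of_jetRank_eq_zero
    (fun y hy => jetRank_eq_zero_of_horizontalRank hr hf hy) hxf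
  -- The rotation is chosen at `x` only. Being constant, it preserves constancy of the 1-jet, so the
  -- canonical form at `x` persists on `N`.
  obtain ⟨Y, hY, p1, p3, p0, p4, p2⟩ := (hDZ x).exists_canonical_rotate f hxf
  have hc : ∀ k : Fin 2, ∀ y ∈ N, (f.rotate Y hY).curvatureDeriv k y
      = (f.rotate Y hY).curvatureDeriv k x := fun k y hy => by
    rw [f.curvatureDeriv_rotate Y hY k (hNf hy), f.curvatureDeriv_rotate Y hY k hxf]
    exact congrArg (pull Y) (congrFun (hconst y hy) k)
  set h := f.rotate Y hY with hh
  obtain ⟨κ, hκ⟩ := h.riemann_eq_axialCurvature (x := x) hxf p1 p3 p0 p4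
  have hR : ∀ y ∈ N, ∀ a b c d, h.riemann a b c d y
      = axialCurvature κ (3 * h.psi 2 x) a b c d := fun y hy a b c d => by
    rw [← hκ]
    exact congrFun (hc 0 y hy) ![a, b, c, d]
  have h2 := h.curvatureDeriv_two_const hN hNf (mul_ne_zero three_ne_zero p2) hR
    (T₁ := h.curvatureDeriv 1 x) (fun y hy => hc 1 y hy) hxN
  refine ⟨h, N, hNf, hN, hxN, fun y hy => funext fun k => ?_⟩
  fin_cases k
  · exact hc 0 y hy
  · exact hc 1 y hy
  · exact h2 y hy

/-- The normalized frame may be unrelated to the one with constant 2-jet, but its values at `x` and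
at nearby `y` lie in one orbit and both in `S`, hence agree. -/
theorem exists_const_of_isNormalized (hDZ : g.IsTypeDZ) (hCH : g.IsCH 1)
    {S : Set (CurvatureSpace 2)} (hS : g.IsNormalizingCrossSection S) {e : MovingFrame g}
    (he : e.IsNormalized S) {x : M} (hx : x ∈ e.domain) :
    ∃ N ⊆ e.domain, IsOpen N ∧ x ∈ N ∧ ∀ y ∈ N, e.curvatureJet 2 y = e.curvatureJet 2 x := by
  obtain ⟨h, N, hNh, hN, hxN, hconst⟩ := exists_frame_curvatureJet_two_const hDZ hCH x
  refine ⟨e.domain ∩ N, Set.inter_subset_left, e.isOpen_domain.inter hN, ⟨hx, hxN⟩, ?_⟩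
  rintro y ⟨hye, hyN⟩
  obtain ⟨X, hX, hXe⟩ := h.exists_curvatureAct e ⟨hNh hxN, hx⟩
  obtain ⟨X', hX', hXe'⟩ := e.exists_curvatureAct h ⟨hye, hNh hyN⟩
  refine hS.eq_of_curvatureAct (lorentzGroup.mul_mem hX' hX) (he x hx) (he y hye) ?_
  rw [curvatureAct_mul, ← hXe, hXe', hconst y hyN]

theorem horizontalRank_eq_zero (hDZ : g.IsTypeDZ) (hCH : g.IsCH 1)
    {S : Set (CurvatureSpace 2)} (hS : g.IsNormalizingCrossSection S) :
    g.horizontalRank S = 0 := by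
  unfold horizontalRank
  refine Nat.le_zero.mp (csSup_le' ?_)
  rintro r ⟨e, he, x, hx, rfl⟩
  obtain ⟨N, hNe, hN, hxN, hconst⟩ := exists_const_of_isNormalized hDZ hCH hS he hx
  exact (e.jetRank_eq_zero_of_const hN hxN hconst).le

end LorentzianMetric

end

end LorentzThree

open LorentzThree in
theorem mainTheorem8 {M : Type*} [TopologicalSpace M]
    [ChartedSpace (EuclideanSpace ℝ (Fin 3)) M] [IsManifold (𝓡 3) ∞ M]
    (g : LorentzianMetric M) (hDZ : g.IsTypeDZ) :
    ¬ g.IsProperlyCH 1 ∧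
      (g.IsCH 1 → ∀ S : Set (CurvatureSpace 2), g.IsNormalizingCrossSection S →
        ∀ C : Set M, IsPreconnected C → ∃ c : CurvatureSpace 2,
          ∀ e : MovingFrame g, e.IsNormalized S →
            ∀ x ∈ C ∩ e.domain, e.curvatureJet 2 x = c) := by
  refine ⟨?_, fun hCH S hS C hC => ?_⟩
  · rintro ⟨hCH, S, hS, hpos⟩
    exact hpos.ne' (LorentzianMetric.horizontalRank_eq_zero hDZ hCH hS)
  · choose E hE hEn using hS.cover
    -- The invariants do not depend on the normalized frame, so evaluating at each point in its own
    -- chosen frame gives a globally defined function on `M`.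
    have hF : IsLocallyConstant fun x => (E x).curvatureJet 2 x := by
      rw [IsLocallyConstant.iff_exists_open]
      intro x
      obtain ⟨N, hNE, hN, hxN, hconst⟩ :=
        LorentzianMetric.exists_const_of_isNormalized hDZ hCH hS (hEn x) (hE x)
      refine ⟨N, hN, hxN, fun y hy => ?_⟩
      rw [hS.curvatureJet_eq (hEn x) (hEn y) (hNE hy) (hE y), hconst y hy]
    rcases C.eq_empty_or_nonempty with rfl | ⟨x₀, hx₀⟩
    · exact ⟨0, fun e _ x hx => absurd hx.1 (Set.notMem_empty x)⟩
    · refine ⟨(E x₀).curvatureJet 2 x₀, fun e he x hx => ?_⟩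
      rw [hS.curvatureJet_eq (hEn x) he (hE x) hx.2]
      exact hF.apply_eq_of_isPreconnected hC hx.1 hx₀
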